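/- **Theorem 3.1.** Let $p$ be an odd prime, $|\cdot|_p$ the $p$-adic absolute value on $\mathbb{Q}_p$, $\|x\|_p=\max_i|x_i|_p$ on $\mathbb{Q}_p^n$, and $d^nx$ the Haar measure on $\mathbb{Q}_p^n$ with $\mathrm{vol}(\mathbb{Z}_p^n)=1$. Let $\mathbf S$ be the space of locally constant, compactly supported functions $\mathbb{Q}_p^n\to\mathbb{C}$ and $\mathbf S'$ its dual. Put $\chi(y)=e^{2\pi i\{y\}_p}$, where $\{y\}_p$ is the $p$-adic fractional part, and $(\mathcal F\varphi)(\xi)=\int\chi(-\xi\cdot x)\varphi(x)\,d^nx$. Let $\Psi=\{\psi\in\mathbf S:\psi(0)=0\}$, $\Phi=\mathcal F[\Psi]\subset\mathbf S$, and let $\Phi'=\Phi'(\mathbb{Q}_p^n)$ be the dual of $\Phi$ (the Lizorkin distributions of the second kind). Let $f$ be one of the following quadratic forms on $\mathbb{Q}_p^n$, with the indicated integer $e$ (off the origin $|f|_p$ takes exactly the values in $p^{e\mathbb{Z}}$): * $n=4$, $e=1$: $f(x)=x_1^2-ax_2^2-px_3^2+apx_4^2$ with $a\in\mathbb{Z}$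 a quadratic non-residue modulo $p$; * $n=2$: $f(x)=x_1^2-\eta x_2^2$ with $\eta=\epsilon$ and $e=2$, or with $\eta\in\{p,\epsilon p\}$ and $e=1$, where $\epsilon\in\mathbb{Z}_p^\times$ is not a square in $\mathbb{Q}_p$. Put $P=\{\frac n2+\frac{2\pi i k}{e\ln p}:k\in\mathbb{Z}\}$. The Riesz kernels $K_\alpha$, $\alpha\in\mathbb{C}$, attached to $f$ are defined as follows. For $\operatorname{Re}\alpha>0$, $\alpha\notin P$, and $\varphi\in\mathbf S$, $$\langle K_\alpha,\varphi\rangle=\frac{1-p^{-e\alpha}}{1-p^{e(\alpha-n/2)}}\int_{\{f\neq0\}}|f(x)|_p^{\alpha-n/2}\,\varphi(x)\,d^nx ,$$ an absolutely convergent integral. For $\alpha\in\mathbb{C}\setminus P$, $K_\alpha\in\mathbf S'$ is given by the continuation of this that, for every $\varphi$, is meromorphic on $\mathbb{C}$ and holomorphic on $\mathbb{C}\setminus P$. For $\alpha\in P$, $K_\alpha\in\Phi'$ is induced by the locally integrable function $-\frac{1-p^{-en/2}}{e\ln p}\ln|f(x)|_p$. (For $n=4$ the factor is $\frac{1-p^{-\alpha}}{1-p^{\alpha-2}}$,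 $P=\{2+\frac{2\pi ik}{\ln p}\}$, and the logarithmic kernel is $-\frac{1-p^{-2}}{\ln p}\ln|f|_p$.) These conditions determine exactly one family $(K_\alpha)_{\alpha\in\mathbb{C}}$ in $\Phi'$, and for all $\alpha,\beta\in\mathbb{C}$ $$K_\alpha * K_\beta=K_{\alpha+\beta}\quad\text{in }\Phi'(\mathbb{Q}_p^n).$$ Here $J*L=H$ in $\Phi'$ means that, for all $T,R\in\mathbf S'$ whose restrictions to $\Phi$ are $J$ and $L$, and all $\varphi\in\Phi$, $$\lim_{k\to+\infty}\big\langle T(y)\times R(x),\,\Delta_k(x)\varphi(x+y)\big\rangle=\langle H,\varphi\rangle ,$$ with $\Delta_k$ the characteristic function of $\{\|x\|_p\le p^k\}$. Consequently $\{K_\alpha:\alpha\in\mathbb{C}\}\subset\Phi'$ is an abelian group under convolution, with unit the Dirac distribution $\delta$. -/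

import Mathlib

open MeasureTheory Filter Topology

noncomputable section

namespace PadicRiesz

/-! ### Haar measure -/

instance instMeasurableSpacePadic (p : ℕ) [Fact p.Prime] : MeasurableSpace ℚ_[p] := borel _

instance instBorelSpacePadic (p : ℕ) [Fact p.Prime] : BorelSpace ℚ_[p] := ⟨rfl⟩

/-- The closed unit ball `ℤ_p` of `ℚ_p`, a compact set with nonempty interior. -/
def unitBall (p : ℕ) [Fact p.Prime] : TopologicalSpace.PositiveCompacts ℚ_[p] where
  carrier := Metric.closedBall 0 1
  isCompact' := isCompact_closedBall 0 1
  interior_nonempty' :=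
    ⟨0, Metric.ball_subset_interior_closedBall (Metric.mem_ball_self one_pos)⟩

/-- The Haar measure of `ℚ_p` with `vol ℤ_p = 1`. On `Fin n → ℚ_[p]`, Mathlib's `volume` is then
the product measure, i.e. the Haar measure with `vol (ℤ_p ^ n) = 1`. -/
instance instMeasureSpacePadic (p : ℕ) [Fact p.Prime] : MeasureSpace ℚ_[p] where
  volume := Measure.addHaarMeasure (unitBall p)

instance instIsAddHaarMeasurePadic (p : ℕ) [Fact p.Prime] :
    (volume : Measure ℚ_[p]).IsAddHaarMeasure :=
  inferInstanceAs (Measure.addHaarMeasure (unitBall p)).IsAddHaarMeasure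

/-! ### The standard additive character -/

theorem norm_mul_pow_le_one {p : ℕ} [Fact p.Prime] (x : ℚ_[p]) :
    ‖x * (p : ℚ_[p]) ^ (-x.valuation).toNat‖ ≤ 1 := by
  have hp : (1 : ℝ) < p := by exact_mod_cast (Fact.out : p.Prime).one_lt
  by_cases hx : x = 0
  · simp [hx]
  · rw [norm_mul, norm_pow, Padic.norm_p, Padic.norm_eq_zpow_neg_valuation hx, inv_pow,
      ← zpow_natCast, ← zpow_neg, ← zpow_add₀ (by positivity)]
    exact zpow_le_one_of_nonpos₀ hp.le (by omega)

/-- The fractional part `{x}_p`. If `ord x = -k < 0`, then `p ^ k * x` is a `p`-adic integer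
`∑ x_j p ^ j`, whose truncation `∑_{j < k} x_j p ^ j` is `PadicInt.appr _ k`. If `x = 0` or
`ord x ≥ 0`, then `k = 0` and the value is `0`. -/
def fract {p : ℕ} [Fact p.Prime] (x : ℚ_[p]) : ℚ :=
  (PadicInt.appr ⟨x * (p : ℚ_[p]) ^ (-x.valuation).toNat, norm_mul_pow_le_one x⟩
    (-x.valuation).toNat : ℚ) / (p : ℚ) ^ (-x.valuation).toNat

/-- The additive character `χ(x) = exp (2 π i {x}_p)`. -/
def chi {p : ℕ} [Fact p.Prime] (x : ℚ_[p]) : ℂ :=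
  Complex.exp (2 * Real.pi * Complex.I * ((fract x : ℚ) : ℂ))

theorem norm_sub_appr_le {p : ℕ} [Fact p.Prime] (y : ℤ_[p]) (k : ℕ) :
    ‖(y : ℚ_[p]) - (PadicInt.appr y k : ℚ_[p])‖ ≤ (p : ℝ) ^ (-(k : ℤ)) := by
  have h := PadicInt.appr_spec k y
  rw [← PadicInt.norm_le_pow_iff_mem_span_pow, PadicInt.norm_def, PadicInt.coe_sub,
    PadicInt.coe_natCast] at h
  exact h

theorem norm_sub_fract_le_one {p : ℕ} [Fact p.Prime] (x : ℚ_[p]) :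
    ‖x - ((fract x : ℚ) : ℚ_[p])‖ ≤ 1 := by
  have hp : (p : ℚ_[p]) ≠ 0 := by exact_mod_cast (Fact.out : p.Prime).ne_zero
  have hnp : (p : ℝ) ≠ 0 := by exact_mod_cast (Fact.out : p.Prime).ne_zero
  set k := (-x.valuation).toNat with hk
  set N := PadicInt.appr (⟨x * (p : ℚ_[p]) ^ k, norm_mul_pow_le_one x⟩ : ℤ_[p]) k with hN
  have hf : ((fract x : ℚ) : ℚ_[p]) = (N : ℚ_[p]) / (p : ℚ_[p]) ^ k := by
    rw [show fract x = (N : ℚ) / (p : ℚ) ^ k from rfl, Rat.cast_div, Rat.cast_pow,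
      Rat.cast_natCast, Rat.cast_natCast]
  have h2 : ‖x * (p : ℚ_[p]) ^ k - (N : ℚ_[p])‖ ≤ (p : ℝ) ^ (-(k : ℤ)) :=
    norm_sub_appr_le _ k
  have h3 : x - (N : ℚ_[p]) / (p : ℚ_[p]) ^ k
      = (x * (p : ℚ_[p]) ^ k - (N : ℚ_[p])) * ((p : ℚ_[p]) ^ k)⁻¹ := by
    rw [sub_mul, mul_assoc, mul_inv_cancel₀ (pow_ne_zero _ hp), mul_one, div_eq_mul_inv]
  rw [hf, h3, norm_mul, norm_inv, norm_pow, Padic.norm_p, inv_pow, inv_inv]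
  calc _ ≤ (p : ℝ) ^ (-(k : ℤ)) * (p : ℝ) ^ k := by gcongr
    _ = 1 := by
      rw [zpow_neg, zpow_natCast]
      exact inv_mul_cancel₀ (pow_ne_zero _ hnp)

theorem fract_mul_pow {p : ℕ} [Fact p.Prime] (x : ℚ_[p]) :
    ∃ (m : ℤ) (k : ℕ), fract x = (m : ℚ) / (p : ℚ) ^ k :=
  ⟨_, _, by rw [Int.cast_natCast]; rfl⟩

theorem eq_intCast_of_norm_le_one {p : ℕ} [Fact p.Prime] (m : ℤ) (k : ℕ)
    (h : ‖(((m : ℚ) / (p : ℚ) ^ k : ℚ) : ℚ_[p])‖ ≤ 1) : ∃ j : ℤ, (m : ℚ) / (p : ℚ) ^ k = j := by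
  have hp0 : (p : ℚ) ≠ 0 := by exact_mod_cast (Fact.out : p.Prime).ne_zero
  have hpp : (0 : ℝ) < p := by exact_mod_cast (Fact.out : p.Prime).pos
  have h2 : ‖(m : ℚ_[p])‖ ≤ (p : ℝ) ^ (-(k : ℤ)) := by
    push_cast at h
    rw [norm_div, norm_pow, Padic.norm_p, inv_pow, div_inv_eq_mul] at h
    rw [zpow_neg, zpow_natCast, ← one_div, le_div_iff₀ (by positivity)]
    exact h
  rw [Padic.norm_int_le_pow_iff_dvd] at h2
  obtain ⟨j, rfl⟩ := h2
  refine ⟨j, ?_⟩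
  push_cast
  field_simp

theorem fract_congr {p : ℕ} [Fact p.Prime] (x y z : ℚ_[p]) (h : ‖x + y - z‖ ≤ 1) :
    ∃ j : ℤ, fract x + fract y - fract z = j := by
  have hp0 : (p : ℚ) ≠ 0 := by exact_mod_cast (Fact.out : p.Prime).ne_zero
  have h1 := norm_sub_fract_le_one x
  have h2 := norm_sub_fract_le_one y
  have h3 := norm_sub_fract_le_one z
  have hn : ‖((fract x + fract y - fract z : ℚ) : ℚ_[p])‖ ≤ 1 := by
    have e : ((fract x + fract y - fract z : ℚ) : ℚ_[p])
        = (x + y - z) - (((x - (fract x : ℚ)) + (y - (fract y : ℚ))) - (z - (fract z : ℚ))) := by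
      push_cast
      ring
    rw [e]
    have hs : ∀ u v : ℚ_[p], ‖u‖ ≤ 1 → ‖v‖ ≤ 1 → ‖u - v‖ ≤ 1 := fun u v hu hv => by
      rw [sub_eq_add_neg]
      exact (Padic.nonarchimedean _ _).trans (max_le hu (by rwa [norm_neg]))
    refine hs _ _ h (hs _ _ ?_ h3)
    exact (Padic.nonarchimedean _ _).trans (max_le h1 h2)
  obtain ⟨m₁, k₁, e₁⟩ := fract_mul_pow x
  obtain ⟨m₂, k₂, e₂⟩ := fract_mul_pow y
  obtain ⟨m₃, k₃, e₃⟩ := fract_mul_pow z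
  have e : fract x + fract y - fract z
      = ((m₁ * p ^ k₂ * p ^ k₃ + m₂ * p ^ k₁ * p ^ k₃ - m₃ * p ^ k₁ * p ^ k₂ : ℤ) : ℚ)
        / (p : ℚ) ^ (k₁ + k₂ + k₃) := by
    rw [e₁, e₂, e₃]
    push_cast
    field_simp
    ring
  rw [e] at hn ⊢
  exact eq_intCast_of_norm_le_one _ _ hn

theorem chi_congr {p : ℕ} [Fact p.Prime] (x y z : ℚ_[p]) (h : ‖x + y - z‖ ≤ 1) :
    chi z = chi x * chi y := by
  obtain ⟨j, hj⟩ := fract_congr x y z h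
  have hj' : ((fract x : ℚ) : ℂ) + ((fract y : ℚ) : ℂ) = ((fract z : ℚ) : ℂ) + j := by
    have : fract x + fract y = fract z + j := by linarith
    exact_mod_cast this
  rw [chi, chi, chi, ← Complex.exp_add, ← mul_add, hj', mul_add, Complex.exp_add]
  rw [show 2 * Real.pi * Complex.I * (j : ℂ) = j * (2 * Real.pi * Complex.I) by ring,
    Complex.exp_int_mul_two_pi_mul_I, mul_one]

theorem chi_zero {p : ℕ} [Fact p.Prime] : chi (0 : ℚ_[p]) = 1 := by
  have h := chi_congr (0 : ℚ_[p]) 0 0 (by simp)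
  have h0 : chi (0 : ℚ_[p]) ≠ 0 := Complex.exp_ne_zero _
  exact (mul_left_cancel₀ h0 (by rw [mul_one]; exact h)).symm

theorem isLocallyConstant_chi {p : ℕ} [Fact p.Prime] : IsLocallyConstant (chi (p := p)) := by
  rw [IsLocallyConstant.iff_eventually_eq]
  intro x
  filter_upwards [Metric.closedBall_mem_nhds x one_pos] with y hy
  have h := chi_congr x 0 y (by
    rw [add_zero, norm_sub_rev, ← dist_eq_norm]
    exact hy)
  rw [h, chi_zero, mul_one]

/-! ### Test functions and distributions -/

/-- The Bruhat-Schwartz space `S(ℚ_p ^ n)`: locally constant functions with compact support. -/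
def schwartz (p : ℕ) [Fact p.Prime] (n : ℕ) : Submodule ℂ ((Fin n → ℚ_[p]) → ℂ) where
  carrier := {φ | IsLocallyConstant φ ∧ HasCompactSupport φ}
  add_mem' := fun h₁ h₂ => ⟨h₁.1.add h₂.1, h₁.2.add h₂.2⟩
  zero_mem' := ⟨IsLocallyConstant.const 0, HasCompactSupport.zero⟩
  smul_mem' := fun c _ h => ⟨h.1.comp (fun z => c * z), h.2.comp_left (mul_zero c)⟩

/-- `S'(ℚ_p ^ n)`: all linear functionals on `S(ℚ_p ^ n)` (each of them is continuous). -/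
abbrev Distribution (p : ℕ) [Fact p.Prime] (n : ℕ) : Type := schwartz p n →ₗ[ℂ] ℂ

/-- The Fourier transform `ξ ↦ ∫ χ(-ξ·x) φ(x) dⁿx`. -/
def fourier {p : ℕ} [Fact p.Prime] {n : ℕ} (φ : (Fin n → ℚ_[p]) → ℂ) (ξ : Fin n → ℚ_[p]) : ℂ :=
  ∫ x : Fin n → ℚ_[p], chi (-(ξ ⬝ᵥ x)) * φ x

theorem integrable_chi_mul {p : ℕ} [Fact p.Prime] {n : ℕ} {φ : (Fin n → ℚ_[p]) → ℂ}
    (h : φ ∈ schwartz p n) (ξ : Fin n → ℚ_[p]) :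
    Integrable (fun x : Fin n → ℚ_[p] => chi (-(ξ ⬝ᵥ x)) * φ x) := by
  have hc : Continuous fun x : Fin n → ℚ_[p] => chi (-(ξ ⬝ᵥ x)) :=
    isLocallyConstant_chi.continuous.comp (by unfold dotProduct; fun_prop)
  exact (hc.mul h.1.continuous).integrable_of_hasCompactSupport h.2.mul_left

/-- `Ψ(ℚ_p ^ n)`: the test functions `ψ` with `ψ(0) = 0`. -/
def lizorkinPsi (p : ℕ) [Fact p.Prime] (n : ℕ) : Submodule ℂ ((Fin n → ℚ_[p]) → ℂ) where
  carrier := {ψ | ψ ∈ schwartz p n ∧ ψ 0 = 0}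
  add_mem' := fun h₁ h₂ => ⟨add_mem h₁.1 h₂.1, by simp [h₁.2, h₂.2]⟩
  zero_mem' := ⟨zero_mem _, rfl⟩
  smul_mem' := fun c _ h => ⟨Submodule.smul_mem _ c h.1, by simp [h.2]⟩

/-- The Lizorkin space of the second kind `Φ(ℚ_p ^ n) = 𝓕[Ψ(ℚ_p ^ n)]`, as a subspace of
`S(ℚ_p ^ n)`. -/
def lizorkinPhi (p : ℕ) [Fact p.Prime] (n : ℕ) : Submodule ℂ (schwartz p n) where
  carrier := {φ | ∃ ψ ∈ lizorkinPsi p n, (φ : (Fin n → ℚ_[p]) → ℂ) = fourier ψ}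
  add_mem' := by
    rintro φ₁ φ₂ ⟨ψ₁, h₁, e₁⟩ ⟨ψ₂, h₂, e₂⟩
    refine ⟨ψ₁ + ψ₂, add_mem h₁ h₂, ?_⟩
    funext ξ
    have := integral_add (integrable_chi_mul h₁.1 ξ) (integrable_chi_mul h₂.1 ξ)
    simp only [fourier, Pi.add_apply, mul_add, Submodule.coe_add, e₁, e₂] at this ⊢
    exact this.symm
  zero_mem' := ⟨0, zero_mem _, by funext ξ; simp [fourier]⟩
  smul_mem' := by
    rintro c φ ⟨ψ, h, e⟩
    refine ⟨c • ψ, Submodule.smul_mem _ c h, ?_⟩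
    funext ξ
    simp only [fourier, Pi.smul_apply, smul_eq_mul, Submodule.coe_smul, e, mul_left_comm _ c,
      integral_const_mul]

/-- `Φ'(ℚ_p ^ n)`: the Lizorkin distributions of the second kind (every linear functional on `Φ`
is continuous). -/
abbrev LizorkinDistribution (p : ℕ) [Fact p.Prime] (n : ℕ) : Type := lizorkinPhi p n →ₗ[ℂ] ℂ

/-- The restriction map `S' → Φ'`. -/
def restrict {p : ℕ} [Fact p.Prime] {n : ℕ} (T : Distribution p n) : LizorkinDistribution p n :=
  T ∘ₗ (lizorkinPhi p n).subtype

/-- The Dirac distribution at the origin. -/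
def dirac (p : ℕ) [Fact p.Prime] (n : ℕ) : Distribution p n where
  toFun := fun φ => (φ : (Fin n → ℚ_[p]) → ℂ) 0
  map_add' := fun _ _ => rfl
  map_smul' := fun _ _ => rfl

/-! ### Convolution -/

theorem exists_radius {p : ℕ} [Fact p.Prime] {n : ℕ} {φ : (Fin n → ℚ_[p]) → ℂ}
    (h : φ ∈ schwartz p n) : ∃ r > 0, ∀ x h : Fin n → ℚ_[p], ‖h‖ < r → φ (x + h) = φ x := by
  have hfin : (Set.range φ).Finite := by
    have h1 : IsCompact (Set.range φ) := h.2.isCompact_range h.1.continuous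
    have h2 : IsCompact (tsupport φ) := h.2
    have h3 : (φ '' tsupport φ).Finite := by
      have : CompactSpace (tsupport φ) := isCompact_iff_compactSpace.mp h2
      have := (h.1.comp_continuous (continuous_subtype_val (p := (· ∈ tsupport φ)))).range_finite
      rwa [Set.range_comp, Subtype.range_coe_subtype] at this
    refine (h3.union (Set.finite_singleton 0)).subset ?_
    rintro _ ⟨x, rfl⟩
    by_cases hx : x ∈ tsupport φ
    · exact Or.inl ⟨x, hx, rfl⟩
    · exact Or.inr (image_eq_zero_of_notMem_tsupport hx)
  have huc : UniformContinuous φ := h.2.uniformContinuous_of_continuous h.1.continuous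
  obtain ⟨δ, hδ, hsep⟩ : ∃ δ > 0, ∀ a ∈ Set.range φ, ∀ b ∈ Set.range φ, dist a b < δ → a = b := by
    by_cases hs : (Set.range φ).Nontrivial
    · exact ⟨(Set.range φ).infsep, hfin.infsep_pos_iff_nontrivial.mpr hs, fun a ha b hb hab => by
        by_contra hne
        exact absurd (Set.infsep_le_dist_of_mem ha hb hne) (not_le.mpr hab)⟩
    · rw [Set.not_nontrivial_iff] at hs
      exact ⟨1, one_pos, fun a ha b hb _ => hs ha hb⟩
  obtain ⟨r, hr, hr'⟩ := Metric.uniformContinuous_iff.mp huc δ hδ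
  refine ⟨r, hr, fun x y hy => hsep _ ⟨_, rfl⟩ _ ⟨_, rfl⟩ (hr' ?_)⟩
  simpa [dist_eq_norm] using hy

/-- The translate `y ↦ φ(x + y)` of a test function. -/
def translate {p : ℕ} [Fact p.Prime] {n : ℕ} (φ : schwartz p n) (x : Fin n → ℚ_[p]) :
    schwartz p n :=
  ⟨fun y => (φ : (Fin n → ℚ_[p]) → ℂ) (x + y),
    φ.2.1.comp_continuous (continuous_const_add x),
    φ.2.2.comp_homeomorph (Homeomorph.addLeft x)⟩

theorem truncated_mem {p : ℕ} [Fact p.Prime] {n : ℕ} (T : Distribution p n) (φ : schwartz p n)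
    (k : ℕ) : (Metric.closedBall (0 : Fin n → ℚ_[p]) ((p : ℝ) ^ k)).indicator
      (fun x => T (translate φ x)) ∈ schwartz p n := by
  have hp : (p : ℝ) ^ k ≠ 0 :=
    pow_ne_zero _ (by exact_mod_cast (Fact.out : p.Prime).ne_zero)
  constructor
  · obtain ⟨r, hr, hφ⟩ := exists_radius φ.2
    have hT : IsLocallyConstant fun x => T (translate φ x) := by
      rw [IsLocallyConstant.iff_eventually_eq]
      intro x
      filter_upwards [Metric.ball_mem_nhds x hr] with y hy
      congr 1
      ext z
      have := hφ (x + z) (y - x) (by rwa [← dist_eq_norm])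
      rw [show x + z + (y - x) = y + z by abel] at this
      exact this
    have hcl : IsClopen (Metric.closedBall (0 : Fin n → ℚ_[p]) ((p : ℝ) ^ k)) :=
      IsUltrametricDist.isClopen_closedBall _ hp
    exact (LocallyConstant.indicator ⟨_, hT⟩ hcl).isLocallyConstant
  · exact HasCompactSupport.intro (isCompact_closedBall 0 ((p : ℝ) ^ k))
      fun x hx => Set.indicator_of_notMem hx _

/-- The test function `x ↦ Δ_k(x) ⟨T(y), φ(x + y)⟩`, with `Δ_k` the indicator function of the ball
of radius `p ^ k` about `0`. Hence `⟨T(y) × R(x), Δ_k(x) φ(x + y)⟩ = R (truncated T φ k)`. -/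
def truncated {p : ℕ} [Fact p.Prime] {n : ℕ} (T : Distribution p n) (φ : schwartz p n) (k : ℕ) :
    schwartz p n :=
  ⟨_, truncated_mem T φ k⟩

/-- `J ∗ L` exists in `Φ'` and equals `H`: for all distributions `T`, `R` on `S` that represent
`J`, `L` and for all `φ ∈ Φ`, the limit
`lim_{k → ∞} ⟨T(y) × R(x), Δ_k(x) φ(x + y)⟩` exists and equals `⟨H, φ⟩`. -/
def IsConvolution {p : ℕ} [Fact p.Prime] {n : ℕ} (J L H : LizorkinDistribution p n) : Prop :=
  ∀ T R : Distribution p n, restrict T = J → restrict R = L → ∀ φ : lizorkinPhi p n,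
    Tendsto (fun k : ℕ => R (truncated T (φ : schwartz p n) k)) atTop (𝓝 (H φ))

/-! ### Quadratic forms and Riesz kernels -/

/-- The diagonal quadratic form with coefficients `c`. -/
def quadForm {p : ℕ} [Fact p.Prime] {n : ℕ} (c : Fin n → ℚ_[p]) (x : Fin n → ℚ_[p]) : ℚ_[p] :=
  ∑ i, c i * x i ^ 2

/-- The elliptic forms under consideration. The last argument `e` is the positive integer such that
`|f|_p` takes, off the origin, exactly the values in `p ^ (e ℤ)`. -/
inductive IsRieszForm (p : ℕ) [Fact p.Prime] : (n : ℕ) → (Fin n → ℚ_[p]) → ℕ → Prop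
  | quaternary (a : ℤ) (ha : ¬ IsSquare (a : ZMod p)) :
      IsRieszForm p 4 ![1, -(a : ℚ_[p]), -(p : ℚ_[p]), (a : ℚ_[p]) * (p : ℚ_[p])] 1
  | binary_unit (ε : ℚ_[p]) (hε : ‖ε‖ = 1) (hsq : ¬ IsSquare ε) : IsRieszForm p 2 ![1, -ε] 2
  | binary_prime : IsRieszForm p 2 ![1, -(p : ℚ_[p])] 1
  | binary_unit_mul_prime (ε : ℚ_[p]) (hε : ‖ε‖ = 1) (hsq : ¬ IsSquare ε) :
      IsRieszForm p 2 ![1, -(ε * (p : ℚ_[p]))] 1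

/-- The exceptional parameters `α = n/2 + 2 π i k / (e ln p)`, `k ∈ ℤ`. -/
def poles (p n e : ℕ) : Set ℂ :=
  {α | ∃ k : ℤ, α = (n : ℂ) / 2 + 2 * Real.pi * Complex.I * k / (e * Real.log p)}

/-- The gamma factor `(1 - p ^ (-e α)) / (1 - p ^ (e (α - n/2)))`. -/
def gammaFactor (p n e : ℕ) (α : ℂ) : ℂ :=
  (1 - (p : ℂ) ^ (-(e * α))) / (1 - (p : ℂ) ^ (e * (α - (n : ℂ) / 2)))

/-- `Z` is the meromorphic continuation, as a distribution on `S`, of the Riesz kernel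
`gammaFactor α * |f|_p ^ (α - n/2)` from `Re α > 0`: it is given there by the absolutely convergent
integral, and for each test function it is meromorphic in `α ∈ ℂ` and holomorphic off the
exceptional parameters. -/
structure IsContinuation {p : ℕ} [Fact p.Prime] {n : ℕ} (c : Fin n → ℚ_[p]) (e : ℕ)
    (Z : ℂ → Distribution p n) : Prop where
  integrable : ∀ α : ℂ, 0 < α.re → α ∉ poles p n e → ∀ φ : schwartz p n,
    IntegrableOn (fun x => (‖quadForm c x‖ : ℂ) ^ (α - (n : ℂ) / 2) * φ.1 x)
      {x | quadForm c x ≠ 0}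
  eq_integral : ∀ α : ℂ, 0 < α.re → α ∉ poles p n e → ∀ φ : schwartz p n,
    Z α φ = gammaFactor p n e α *
      ∫ x in {x | quadForm c x ≠ 0}, (‖quadForm c x‖ : ℂ) ^ (α - (n : ℂ) / 2) * φ.1 x
  meromorphic : ∀ φ : schwartz p n, MeromorphicOn (fun α => Z α φ) Set.univ
  holomorphic : ∀ φ : schwartz p n, DifferentiableOn ℂ (fun α => Z α φ) (poles p n e)ᶜ

/-- `K` is the family of Riesz kernels `K_α ∈ Φ'`, `α ∈ ℂ`, attached to the form `f` with
coefficients `c`: off the exceptional parameters it is the meromorphic continuation, and at an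
exceptional parameter it is induced by the locally integrable function
`-(1 - p ^ (-e n/2)) / (e ln p) * ln |f|_p`. -/
structure IsRieszFamily {p : ℕ} [Fact p.Prime] {n : ℕ} (c : Fin n → ℚ_[p]) (e : ℕ)
    (K : ℂ → LizorkinDistribution p n) : Prop where
  continuation : ∃ Z : ℂ → Distribution p n, IsContinuation c e Z ∧
    ∀ α, α ∉ poles p n e → K α = restrict (Z α)
  log_integrable : LocallyIntegrable fun x => Real.log ‖quadForm c x‖
  log_kernel : ∀ α ∈ poles p n e, ∀ φ : lizorkinPhi p n,
    K α φ = -((1 - (p : ℂ) ^ (-(e * ((n : ℂ) / 2)))) / (e * Real.log p)) *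
      ∫ x in {x | quadForm c x ≠ 0}, (Real.log ‖quadForm c x‖ : ℂ) * φ.1.1 x

end PadicRiesz

end

/-!
On the Lizorkin space `Φ` the Riesz kernels are Fourier multipliers, and the multiplier of `K α` is
the `α`-th power of a fixed function; this is why `K α ∗ K β = K (α + β)`. The proof makes the
multipliers visible without computing transforms of distributions.

For each of the forms `f`, the norm `‖f x‖` is the maximum of the norms of the diagonal terms (by
Hensel's lemma, and because even and odd orders cannot cancel). Hence `L j = {‖f‖ ≤ p ^ (e j)}` is
an increasing chain of lattices, and `L j` has volume `q ^ j` with `q = p ^ (e n / 2)`. The averages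
`A j` over these lattices satisfy `A i ∘ A j = A (max i j)`, so the details `D j = A j - A (j + 1)`
are mutually orthogonal projections. Fourier inversion identifies `Φ` with the test functions of
integral zero (`mem_lizorkinPhi_iff`), and for these only finitely many details are nonzero and
`φ = ∑ D j φ`. The functional `kernel t : φ ↦ ∑ t ^ j (D j φ)(0)` therefore acts by convolution as
multiplication by `t ^ j` on the `j`-th detail, which maps `Φ` to itself: the truncations in the
definition of convolution are eventually inactive, and the choice of the extensions to `S` is
irrelevant (`isConvolution_kernel`).

It remains to see that `K α = kernel (p ^ (e α))`. The integral of `‖f‖ ^ (α - n / 2) φ`, split over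
the shells `L j \ L (j - 1)`, is `∑ t ^ j b j` with `t = p ^ (e α)` and shell means `b j` of `φ`.
Summation by parts turns `(1 - t⁻¹) ∑ t ^ j b j` into the finite sum `∑ t ^ j (b j - b (j + 1))`,
which is entire in `α` and gives the continuation; on `Φ` it equals `(1 - t / q) kernel t`
(`integral_power_kernel`, `restrict_regularized`). At the exceptional parameters `t = q`, and
another summation by parts identifies `kernel q` with the logarithmic kernel (`integral_log_kernel`).
Uniqueness of the continuation is the identity theorem on the complement of the countable closed
set of exceptional parameters.
-/

open MeasureTheory Filter Topology

noncomputable section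

namespace PadicRiesz

/-! ### Volumes of balls -/

section Volume

variable {p : ℕ} [Fact p.Prime]

theorem cast_prime_pos : (0 : ℝ) < p := by exact_mod_cast (Fact.out : p.Prime).pos

theorem cast_prime_one_lt : (1 : ℝ) < p := by exact_mod_cast (Fact.out : p.Prime).one_lt

theorem padic_prime_ne_zero : (p : ℚ_[p]) ≠ 0 := by exact_mod_cast (Fact.out : p.Prime).ne_zero

/-- A ball of radius `p ^ (k + 1)` is the disjoint union of `p` translates of the ball of radius
`p ^ k`. -/
theorem closedBall_succ_eq_iUnion (k : ℤ) :
    Metric.closedBall (0 : ℚ_[p]) ((p : ℝ) ^ (k + 1)) =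
      ⋃ i ∈ Finset.range p, (fun x => (i : ℚ_[p]) * (p : ℚ_[p]) ^ (-(k + 1)) + x) ''
        Metric.closedBall (0 : ℚ_[p]) ((p : ℝ) ^ k) := by
  have hp := cast_prime_pos (p := p)
  have hp0 := padic_prime_ne_zero (p := p)
  ext x
  simp only [Set.mem_iUnion, Set.mem_image, mem_closedBall_zero_iff, Finset.mem_range]
  constructor
  · intro hx
    have hy : ‖x * (p : ℚ_[p]) ^ (k + 1)‖ ≤ 1 := by
      rw [norm_mul, Padic.norm_p_zpow]
      calc _ ≤ (p : ℝ) ^ (k + 1) * (p : ℝ) ^ (-(k + 1)) := by gcongr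
        _ = 1 := by rw [← zpow_add₀ hp.ne']; simp
    obtain ⟨y, hy⟩ : ∃ y : ℤ_[p], (y : ℚ_[p]) = x * (p : ℚ_[p]) ^ (k + 1) := ⟨⟨_, hy⟩, rfl⟩
    obtain ⟨i, hi, hi'⟩ := PadicInt.exists_mem_range y
    refine ⟨i, hi, x - i * (p : ℚ_[p]) ^ (-(k + 1)), ?_, by ring⟩
    have h1 := (PadicInt.norm_le_pow_iff_mem_span_pow (y - (i : ℤ_[p])) 1).mpr (by
        rw [pow_one, ← PadicInt.maximalIdeal_eq_span_p]; exact hi')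
    rw [PadicInt.norm_def, PadicInt.coe_sub, PadicInt.coe_natCast, hy] at h1
    have e : x - i * (p : ℚ_[p]) ^ (-(k + 1)) =
        (x * (p : ℚ_[p]) ^ (k + 1) - i) * (p : ℚ_[p]) ^ (-(k + 1)) := by
      rw [sub_mul, mul_assoc, ← zpow_add₀ hp0]; simp
    rw [e, norm_mul, Padic.norm_p_zpow]
    calc _ ≤ (p : ℝ) ^ (-(1 : ℕ) : ℤ) * (p : ℝ) ^ (- -(k + 1)) := by gcongr
      _ = _ := by rw [← zpow_add₀ hp.ne']; congr 1; push_cast; ring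
  · rintro ⟨i, hi, y, hy, rfl⟩
    refine (Padic.nonarchimedean _ _).trans (max_le ?_ (hy.trans ?_))
    · rw [norm_mul, Padic.norm_p_zpow, neg_neg]
      refine mul_le_of_le_one_left (by positivity) ?_
      exact_mod_cast Padic.norm_int_le_one (p := p) i
    · exact zpow_le_zpow_right₀ cast_prime_one_lt.le (by omega)

theorem volume_closedBall_succ (k : ℤ) :
    volume (Metric.closedBall (0 : ℚ_[p]) ((p : ℝ) ^ (k + 1))) =
      p * volume (Metric.closedBall (0 : ℚ_[p]) ((p : ℝ) ^ k)) := by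
  have hp := cast_prime_pos (p := p)
  have himg : ∀ i : ℕ, (fun x => (i : ℚ_[p]) * (p : ℚ_[p]) ^ (-(k + 1)) + x) ''
        Metric.closedBall (0 : ℚ_[p]) ((p : ℝ) ^ k) =
      Metric.closedBall ((i : ℚ_[p]) * (p : ℚ_[p]) ^ (-(k + 1))) ((p : ℝ) ^ k) := by
    intro i
    simp
  rw [closedBall_succ_eq_iUnion, measure_biUnion_finset]
  · simp only [himg]
    simp [Measure.addHaar_closedBall_center]
  · intro i hi j hj hij
    rw [Function.onFun, Set.disjoint_left]
    simp only [himg, Metric.mem_closedBall, dist_eq_norm]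
    intro x h1 h2
    have h3 : ‖((i : ℤ) - (j : ℤ) : ℤ) * (p : ℚ_[p]) ^ (-(k + 1))‖ ≤ (p : ℝ) ^ k := by
      have e : (((i : ℤ) - (j : ℤ) : ℤ) : ℚ_[p]) * (p : ℚ_[p]) ^ (-(k + 1)) =
        (x - j * (p : ℚ_[p]) ^ (-(k + 1))) + -(x - i * (p : ℚ_[p]) ^ (-(k + 1))) := by
        push_cast; ring
      rw [e]
      exact (Padic.nonarchimedean _ _).trans (max_le h2 (by rwa [norm_neg]))
    rw [norm_mul, Padic.norm_p_zpow, neg_neg, zpow_add_one₀ hp.ne', mul_comm, mul_assoc] at h3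
    have h4 := (mul_le_iff_le_one_right (zpow_pos hp k)).mp h3
    have h5 : ‖(((i : ℤ) - (j : ℤ) : ℤ) : ℚ_[p])‖ ≤ (p : ℝ) ^ (-(1 : ℕ) : ℤ) := by
      rw [zpow_neg, zpow_natCast, pow_one, ← one_div, le_div_iff₀ hp, mul_comm]; exact h4
    rw [Padic.norm_int_le_pow_iff_dvd, pow_one] at h5
    have hi' := Finset.mem_range.mp hi
    have hj' := Finset.mem_range.mp hj
    apply hij
    have := Int.eq_zero_of_abs_lt_dvd h5 (by rw [abs_lt]; constructor <;> omega)
    omega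
  · intro i _
    rw [himg]
    exact Metric.isClosed_closedBall.measurableSet

theorem volume_real_closedBall (k : ℤ) :
    volume.real (Metric.closedBall (0 : ℚ_[p]) ((p : ℝ) ^ k)) = (p : ℝ) ^ k := by
  have hp := cast_prime_pos (p := p)
  have hs : ∀ k : ℤ, volume.real (Metric.closedBall (0 : ℚ_[p]) ((p : ℝ) ^ (k + 1))) =
      p * volume.real (Metric.closedBall (0 : ℚ_[p]) ((p : ℝ) ^ k)) := fun k => by
    simp [Measure.real, volume_closedBall_succ]
  induction k using Int.induction_on with
  | zero =>
    have : volume (Metric.closedBall (0 : ℚ_[p]) 1) = 1 :=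
      Measure.addHaarMeasure_self (K₀ := unitBall p)
    simp [Measure.real, this]
  | succ k ih => rw [hs, ih, zpow_add_one₀ hp.ne', mul_comm]
  | pred k ih =>
    have := hs (-(k : ℤ) - 1)
    rw [sub_add_cancel, ih] at this
    refine mul_left_cancel₀ hp.ne' ?_
    rw [← this, mul_comm, ← zpow_add_one₀ hp.ne', sub_add_cancel]

theorem volume_real_pi_closedBall {n : ℕ} (k : Fin n → ℤ) :
    volume.real {x : Fin n → ℚ_[p] | ∀ i, ‖x i‖ ≤ (p : ℝ) ^ k i} = (p : ℝ) ^ ∑ i, k i := by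
  have : {x : Fin n → ℚ_[p] | ∀ i, ‖x i‖ ≤ (p : ℝ) ^ k i} =
      Set.univ.pi fun i => Metric.closedBall 0 ((p : ℝ) ^ k i) := by
    ext x; simp
  rw [this, Measure.real, volume_pi_pi, ENNReal.toReal_prod]
  simp_rw [← Measure.real_def, volume_real_closedBall]
  induction (Finset.univ : Finset (Fin n)) using Finset.cons_induction with
  | empty => simp
  | cons a s ha ih => rw [Finset.prod_cons, Finset.sum_cons, zpow_add₀ cast_prime_pos.ne', ih]

theorem volume_real_closedBall_pi (n : ℕ) (k : ℤ) :
    volume.real (Metric.closedBall (0 : Fin n → ℚ_[p]) ((p : ℝ) ^ k)) = (p : ℝ) ^ (n * k) := by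
  have := volume_real_pi_closedBall (p := p) (fun _ : Fin n => k)
  rw [show (∑ _i : Fin n, k) = n * k by simp] at this
  rw [← this]
  congr 1
  ext x
  rw [mem_closedBall_zero_iff, pi_norm_le_iff_of_nonneg (zpow_nonneg cast_prime_pos.le k)]
  rfl

end Volume

/-! ### The Fourier transform of test functions -/

section Fourier

variable {p : ℕ} [Fact p.Prime] {n : ℕ}

theorem chi_add (x y : ℚ_[p]) : chi (x + y) = chi x * chi y :=
  chi_congr x y _ (by simp)

theorem chi_of_norm_le_one {x : ℚ_[p]} (h : ‖x‖ ≤ 1) : chi x = 1 := by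
  have := chi_congr x 0 0 (by simpa using h)
  simpa [chi_zero] using this.symm

theorem norm_le_one_of_chi_eq_one {x : ℚ_[p]} (h : chi x = 1) : ‖x‖ ≤ 1 := by
  rw [chi, Complex.exp_eq_one_iff] at h
  obtain ⟨j, hj⟩ := h
  have h2 : ((fract x : ℚ) : ℂ) = j := by
    have : (2 * Real.pi * Complex.I : ℂ) ≠ 0 := Complex.two_pi_I_ne_zero
    rw [mul_comm (j : ℂ)] at hj
    exact mul_left_cancel₀ this hj
  have h3 : fract x = j := by exact_mod_cast h2
  have h4 := norm_sub_fract_le_one x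
  rw [h3] at h4
  have := Padic.nonarchimedean (x - ((j : ℚ) : ℚ_[p])) ((j : ℚ) : ℚ_[p])
  rw [sub_add_cancel] at this
  refine this.trans (max_le h4 ?_)
  rw [Rat.cast_intCast]
  exact Padic.norm_int_le_one j

theorem continuous_chi_dotProduct :
    Continuous fun z : (Fin n → ℚ_[p]) × (Fin n → ℚ_[p]) => chi (-(z.1 ⬝ᵥ z.2)) :=
  isLocallyConstant_chi.continuous.comp (by unfold dotProduct; fun_prop)

theorem norm_dotProduct_le (x y : Fin n → ℚ_[p]) : ‖x ⬝ᵥ y‖ ≤ ‖x‖ * ‖y‖ := by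
  unfold dotProduct
  refine IsUltrametricDist.norm_sum_le_of_forall_le_of_nonneg (by positivity) fun i _ => ?_
  rw [norm_mul]
  gcongr <;> exact norm_le_pi_norm _ i

/-- A vector outside `p ^ (-N) ℤ_p ^ n` pairs with some vector of `p ^ N ℤ_p ^ n` to a value on which
the character is nontrivial. -/
theorem exists_chi_ne_one {ξ : Fin n → ℚ_[p]} {N : ℤ} (h : (p : ℝ) ^ N < ‖ξ‖) :
    ∃ t : Fin n → ℚ_[p], ‖t‖ ≤ (p : ℝ) ^ (-N) ∧ chi (-(ξ ⬝ᵥ t)) ≠ 1 := by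
  have hp := cast_prime_pos (p := p)
  obtain ⟨i, hi⟩ : ∃ i, (p : ℝ) ^ N < ‖ξ i‖ := by
    by_contra! hc
    exact absurd ((pi_norm_le_iff_of_nonneg (zpow_nonneg hp.le N)).mpr hc) (not_le.mpr h)
  refine ⟨Pi.single i ((p : ℚ_[p]) ^ N), ?_, fun hc => ?_⟩
  · rw [Pi.norm_single, Padic.norm_p_zpow]
  · have := norm_le_one_of_chi_eq_one hc
    rw [dotProduct_single, norm_neg, norm_mul, Padic.norm_p_zpow, zpow_neg,
      ← div_eq_mul_inv, div_le_one (zpow_pos hp N)] at this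
    exact absurd this (not_le.mpr hi)

theorem exists_zpow_le {r : ℝ} (hr : 0 < r) : ∃ N : ℤ, (p : ℝ) ^ N < r := by
  obtain ⟨k, hk⟩ := exists_pow_lt_of_lt_one hr (inv_lt_one_of_one_lt₀ (cast_prime_one_lt (p := p)))
  exact ⟨-k, by rwa [zpow_neg, zpow_natCast, ← inv_pow]⟩

/-- A test function is invariant under a lattice `p ^ (-N) ℤ_p ^ n`. -/
theorem exists_zpow_invariant {φ : (Fin n → ℚ_[p]) → ℂ} (h : φ ∈ schwartz p n) :
    ∃ N : ℤ, ∀ x t : Fin n → ℚ_[p], ‖t‖ ≤ (p : ℝ) ^ N → φ (x + t) = φ x := by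
  obtain ⟨r, hr, hφ⟩ := exists_radius h
  obtain ⟨N, hN⟩ := exists_zpow_le (p := p) hr
  exact ⟨N, fun x t ht => hφ x t (ht.trans_lt hN)⟩

theorem exists_zpow_support {φ : (Fin n → ℚ_[p]) → ℂ} (h : φ ∈ schwartz p n) :
    ∃ M : ℤ, ∀ x : Fin n → ℚ_[p], (p : ℝ) ^ M < ‖x‖ → φ x = 0 := by
  obtain ⟨r, hr⟩ := h.2.isBounded.subset_closedBall 0
  obtain ⟨k, hk⟩ := pow_unbounded_of_one_lt r (cast_prime_one_lt (p := p))
  refine ⟨k, fun x hx => image_eq_zero_of_notMem_tsupport fun hx' => ?_⟩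
  have := mem_closedBall_zero_iff.mp (hr hx')
  rw [zpow_natCast] at hx
  linarith

theorem integrable_of_mem_schwartz {φ : (Fin n → ℚ_[p]) → ℂ} (h : φ ∈ schwartz p n) :
    Integrable φ :=
  h.1.continuous.integrable_of_hasCompactSupport h.2

theorem fourier_add_left (φ : (Fin n → ℚ_[p]) → ℂ) (t ξ : Fin n → ℚ_[p]) :
    fourier (fun x => φ (x + t)) ξ = chi (ξ ⬝ᵥ t) * fourier φ ξ := by
  unfold fourier
  rw [← integral_const_mul,
    ← integral_add_right_eq_self (fun x => chi (ξ ⬝ᵥ t) * (chi (-(ξ ⬝ᵥ x)) * φ x)) t]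
  congr 1
  funext x
  rw [← mul_assoc, ← chi_add]
  congr 2
  rw [dotProduct_add]; ring

/-- The transform of a function invariant under `p ^ (-N) ℤ_p ^ n` is supported in the dual
lattice. -/
theorem fourier_eq_zero {φ : (Fin n → ℚ_[p]) → ℂ} {N : ℤ}
    (hN : ∀ x t : Fin n → ℚ_[p], ‖t‖ ≤ (p : ℝ) ^ N → φ (x + t) = φ x) {ξ : Fin n → ℚ_[p]}
    (hξ : (p : ℝ) ^ (-N) < ‖ξ‖) : fourier φ ξ = 0 := by
  obtain ⟨t, ht, hc⟩ := exists_chi_ne_one hξ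
  rw [neg_neg] at ht
  have h1 : (fun x => φ (x + -t)) = φ := funext fun x => hN x (-t) (by rwa [norm_neg])
  have h2 := fourier_add_left φ (-t) ξ
  rw [h1, dotProduct_neg] at h2
  by_contra h0
  exact hc (mul_right_cancel₀ h0 (by rw [one_mul]; exact h2.symm))

theorem fourier_mem {φ : (Fin n → ℚ_[p]) → ℂ} (h : φ ∈ schwartz p n) :
    fourier φ ∈ schwartz p n := by
  have hp := cast_prime_pos (p := p)
  obtain ⟨N, hN⟩ := exists_zpow_invariant h
  obtain ⟨M, hM⟩ := exists_zpow_support h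
  constructor
  · rw [IsLocallyConstant.iff_eventually_eq]
    intro ξ
    filter_upwards [Metric.closedBall_mem_nhds ξ (zpow_pos hp (-M))] with η hη
    unfold fourier
    congr 1
    funext x
    rcases lt_or_ge ((p : ℝ) ^ M) ‖x‖ with hx | hx
    · simp [hM x hx]
    · congr 1
      have e : -(η ⬝ᵥ x) = -(ξ ⬝ᵥ x) + -((η - ξ) ⬝ᵥ x) := by rw [sub_dotProduct]; ring
      rw [e, chi_add, chi_of_norm_le_one (x := -((η - ξ) ⬝ᵥ x)), mul_one]
      rw [norm_neg]
      rw [mem_closedBall_iff_norm] at hη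
      calc _ ≤ ‖η - ξ‖ * ‖x‖ := norm_dotProduct_le _ _
        _ ≤ (p : ℝ) ^ (-M) * (p : ℝ) ^ M := by gcongr
        _ = 1 := by rw [← zpow_add₀ hp.ne']; simp
  · refine HasCompactSupport.intro (isCompact_closedBall 0 ((p : ℝ) ^ (-N))) fun ξ hξ => ?_
    rw [mem_closedBall_zero_iff, not_le] at hξ
    exact fourier_eq_zero hN hξ

/-- Orthogonality of characters on the lattice of radius `p ^ N`. -/
theorem setIntegral_chi (N : ℤ) (x : Fin n → ℚ_[p]) :
    ∫ ξ in Metric.closedBall (0 : Fin n → ℚ_[p]) ((p : ℝ) ^ N), chi (-(ξ ⬝ᵥ x)) =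
      (Metric.closedBall (0 : Fin n → ℚ_[p]) ((p : ℝ) ^ (-N))).indicator
        (fun _ => ((p : ℂ) ^ (n * N))) x := by
  have hp := cast_prime_pos (p := p)
  rcases le_or_gt ‖x‖ ((p : ℝ) ^ (-N)) with hx | hx
  · rw [Set.indicator_of_mem (mem_closedBall_zero_iff.mpr hx),
      setIntegral_congr_fun (g := fun _ => (1 : ℂ)) Metric.isClosed_closedBall.measurableSet]
    · rw [setIntegral_const, volume_real_closedBall_pi]; simp
    · intro ξ hξ
      refine chi_of_norm_le_one ?_
      rw [norm_neg]
      rw [mem_closedBall_zero_iff] at hξ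
      calc _ ≤ ‖ξ‖ * ‖x‖ := norm_dotProduct_le _ _
        _ ≤ (p : ℝ) ^ N * (p : ℝ) ^ (-N) := by gcongr
        _ = 1 := by rw [← zpow_add₀ hp.ne']; simp
  · rw [Set.indicator_of_notMem (by simpa using hx)]
    obtain ⟨t, ht, hc⟩ := exists_chi_ne_one hx
    rw [neg_neg] at ht
    rw [dotProduct_comm] at hc
    set g : (Fin n → ℚ_[p]) → ℂ :=
      (Metric.closedBall (0 : Fin n → ℚ_[p]) ((p : ℝ) ^ N)).indicator
        fun ξ => chi (-(ξ ⬝ᵥ x)) with hg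
    have hball : ∀ ξ : Fin n → ℚ_[p], ‖t + ξ‖ ≤ (p : ℝ) ^ N ↔ ‖ξ‖ ≤ (p : ℝ) ^ N := by
      intro ξ
      have hu : ∀ a b : Fin n → ℚ_[p], ‖a‖ ≤ (p : ℝ) ^ N → ‖b‖ ≤ (p : ℝ) ^ N →
          ‖a + b‖ ≤ (p : ℝ) ^ N := fun a b ha hb =>
        (IsUltrametricDist.norm_add_le_max a b).trans (max_le ha hb)
      refine ⟨fun h => ?_, hu _ _ ht⟩
      have := hu _ (-t) h (by rwa [norm_neg])
      rwa [show t + ξ + -t = ξ by abel] at this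
    have h1 : ∀ ξ, g (t + ξ) = chi (-(t ⬝ᵥ x)) * g ξ := by
      intro ξ
      simp only [hg, Set.indicator, mem_closedBall_zero_iff, hball]
      split_ifs
      · rw [← chi_add, add_dotProduct]; congr 1; ring
      · simp
    have h2 := integral_add_left_eq_self (μ := volume) g t
    simp only [h1, integral_const_mul] at h2
    rw [← integral_indicator Metric.isClosed_closedBall.measurableSet, ← hg]
    by_contra h0
    exact hc (mul_right_cancel₀ h0 (by rw [one_mul]; exact h2))

/-- Fourier inversion at the origin. -/
theorem integral_fourier {φ : (Fin n → ℚ_[p]) → ℂ} (h : φ ∈ schwartz p n) :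
    ∫ ξ, fourier φ ξ = φ 0 := by
  have hp := cast_prime_pos (p := p)
  have hpc : (p : ℂ) ≠ 0 := by exact_mod_cast hp.ne'
  obtain ⟨N, hN⟩ := exists_zpow_invariant h
  set B := Metric.closedBall (0 : Fin n → ℚ_[p]) ((p : ℝ) ^ (-N)) with hB
  have hBc : IsClopen B := IsUltrametricDist.isClopen_closedBall _ (zpow_pos hp _).ne'
  have hBm : MeasurableSet B := hBc.1.measurableSet
  have h1 : ∫ ξ, fourier φ ξ = ∫ ξ in B, fourier φ ξ := by
    rw [setIntegral_eq_integral_of_forall_compl_eq_zero]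
    intro ξ hξ
    exact fourier_eq_zero hN (by simpa [hB] using hξ)
  have h2 : ∫ ξ in B, fourier φ ξ =
      ∫ ξ, ∫ x, B.indicator (fun _ => (1 : ℂ)) ξ * (chi (-(ξ ⬝ᵥ x)) * φ x) := by
    rw [← integral_indicator hBm]
    congr 1
    funext ξ
    by_cases hξ : ξ ∈ B <;> simp [hξ, fourier]
  have h3 : ∀ x : Fin n → ℚ_[p],
      ∫ ξ, B.indicator (fun _ => (1 : ℂ)) ξ * (chi (-(ξ ⬝ᵥ x)) * φ x) =
        (Metric.closedBall (0 : Fin n → ℚ_[p]) ((p : ℝ) ^ N)).indicator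
          (fun _ => (p : ℂ) ^ (n * -N) * φ 0) x := by
    intro x
    have e : (fun ξ => B.indicator (fun _ => (1 : ℂ)) ξ * (chi (-(ξ ⬝ᵥ x)) * φ x)) =
        fun ξ => B.indicator (fun ξ => chi (-(ξ ⬝ᵥ x))) ξ * φ x := by
      funext ξ
      by_cases hξ : ξ ∈ B <;> simp [hξ]
    rw [e, integral_mul_const, integral_indicator hBm, setIntegral_chi, neg_neg]
    by_cases hx : ‖x‖ ≤ (p : ℝ) ^ N
    · have := hN 0 x hx
      rw [zero_add] at this
      simp [hx, this]
    · simp [hx]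
  rw [h1, h2, integral_integral_swap_of_hasCompactSupport]
  · simp_rw [h3]
    rw [integral_indicator Metric.isClosed_closedBall.measurableSet, setIntegral_const,
      volume_real_closedBall_pi]
    rw [Complex.real_smul, ← mul_assoc]
    push_cast
    rw [← zpow_add₀ hpc]
    simp
  · have hi : Continuous (B.indicator fun _ => (1 : ℂ)) :=
      continuous_const.indicator (by simp [hBc.frontier_eq])
    exact (hi.comp continuous_fst).mul
      (continuous_chi_dotProduct.mul (h.1.continuous.comp continuous_snd))
  · refine HasCompactSupport.intro
      ((isCompact_closedBall (0 : Fin n → ℚ_[p]) ((p : ℝ) ^ (-N))).prod h.2.isCompact) ?_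
    rintro ⟨ξ, x⟩ hz
    rw [Set.mem_prod, not_and_or] at hz
    rcases hz with hz | hz
    · have : ξ ∉ B := hz
      simp [this]
    · simp [image_eq_zero_of_notMem_tsupport hz]

/-- Fourier inversion identifies `Φ` with the test functions of integral zero. -/
theorem mem_lizorkinPhi_iff (φ : schwartz p n) : φ ∈ lizorkinPhi p n ↔ ∫ x, φ.1 x = 0 := by
  constructor
  · rintro ⟨ψ, hψ, e⟩
    rw [e, integral_fourier hψ.1, hψ.2]
  · intro h
    have hF := fourier_mem φ.2
    refine ⟨fun ξ => fourier φ.1 (-ξ), ⟨⟨hF.1.comp_continuous continuous_neg,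
      hF.2.comp_homeomorph (Homeomorph.neg _)⟩, ?_⟩, ?_⟩
    · simp [fourier, chi_zero, h]
    · funext x
      have h1 := integral_fourier (translate φ x).2
      have h2 : (translate φ x).1 0 = φ.1 x := by simp [translate]
      have h3 : (translate φ x).1 = fun y => φ.1 (y + x) := by
        funext y; simp [translate, add_comm]
      rw [h2, h3, ← integral_neg_eq_self] at h1
      rw [← h1]
      unfold fourier
      congr 1
      funext ξ
      have := fourier_add_left φ.1 x (-ξ)
      unfold fourier at this
      rw [this, neg_dotProduct, dotProduct_comm]

end Fourier

/-! ### Norms of the quadratic forms -/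

section Forms

variable {p : ℕ} [Fact p.Prime]

/-- A quadratic form with coefficients `c` in `2 m` variables is *norm-diagonal* if `‖f x‖` is the
maximum of the norms of its terms, all coefficients have norm `1` or `p⁻¹`, its nonzero values have
norm in `p ^ (e ℤ)`, and the lattices `{‖f‖ ≤ p ^ (e j)}` have volume `p ^ (e m j)`. -/
structure IsNormDiagonal {n : ℕ} (c : Fin n → ℚ_[p]) (e m : ℕ) : Prop where
  dim : n = 2 * m
  exponent_pos : 0 < e
  dim_pos : 0 < m
  norm_le_iff : ∀ x r, ‖quadForm c x‖ ≤ r ↔ ∀ i, ‖c i‖ * ‖x i‖ ^ 2 ≤ r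
  norm_coeff : ∀ i, ‖c i‖ = 1 ∨ ‖c i‖ = (p : ℝ)⁻¹
  exists_zpow : ∀ x ≠ 0, ∃ j : ℤ, ‖quadForm c x‖ = ((p : ℝ) ^ e) ^ j
  volume_real : ∀ j : ℤ,
    volume.real {x | ‖quadForm c x‖ ≤ ((p : ℝ) ^ e) ^ j} = ((p : ℝ) ^ (e * m)) ^ j

theorem isSquare_of_norm_sq_sub_lt (hp : p ≠ 2) {u ε : ℚ_[p]} (hε : ‖ε‖ = 1) (hu : ‖u‖ = 1)
    (h : ‖u ^ 2 - ε‖ < 1) : IsSquare ε := by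
  set a : ℤ_[p] := ⟨u, hu.le⟩
  set b : ℤ_[p] := ⟨ε, hε.le⟩
  have h2 : ‖(2 : ℤ_[p])‖ = 1 := by
    have : ¬ ‖((2 : ℤ) : ℤ_[p])‖ < 1 := by
      rw [PadicInt.norm_int_lt_one_iff_dvd]
      intro hd
      have := (Nat.prime_dvd_prime_iff_eq (Fact.out : p.Prime) Nat.prime_two).mp
        (by exact_mod_cast hd)
      exact hp this
    exact le_antisymm (PadicInt.norm_le_one _) (by simpa using this)
  have ha1 : ‖a‖ = 1 := hu
  obtain ⟨z, hz, -⟩ := hensels_lemma (p := p) (R := ℤ_[p])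
    (F := Polynomial.X ^ 2 - Polynomial.C b) (a := a) (by
      simp only [Polynomial.coe_aeval_eq_eval, Polynomial.eval_sub, Polynomial.eval_pow,
        Polynomial.eval_X, Polynomial.eval_C, Polynomial.derivative_sub,
        Polynomial.derivative_X_pow, Polynomial.derivative_C, sub_zero, Polynomial.eval_mul]
      norm_num [h2, ha1]
      exact h)
  simp only [Polynomial.coe_aeval_eq_eval, Polynomial.eval_sub, Polynomial.eval_pow,
    Polynomial.eval_X, Polynomial.eval_C, sub_eq_zero] at hz
  exact ⟨z, by
    have := congrArg (fun t : ℤ_[p] => (t : ℚ_[p])) hz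
    simp only [PadicInt.coe_pow] at this
    rw [← sq, this]⟩

theorem norm_sub_eq_max {x y : ℚ_[p]} (h : ‖x‖ ≠ ‖y‖) : ‖x - y‖ = max ‖x‖ ‖y‖ := by
  rw [sub_eq_add_neg, Padic.add_eq_max_of_ne (by rwa [norm_neg]), norm_neg]

/-- The norm form of the unramified quadratic extension. -/
theorem norm_sq_sub_unit_mul_sq (hp : p ≠ 2) {ε : ℚ_[p]} (hε : ‖ε‖ = 1) (hsq : ¬ IsSquare ε)
    (x y : ℚ_[p]) : ‖x ^ 2 - ε * y ^ 2‖ = max (‖x‖ ^ 2) (‖y‖ ^ 2) := by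
  by_cases hxy : ‖x‖ = ‖y‖
  · by_cases hy : y = 0
    · have hx : x = 0 := by rwa [hy, norm_zero, norm_eq_zero] at hxy
      simp [hx, hy]
    · have hy' : ‖y‖ ≠ 0 := norm_ne_zero_iff.mpr hy
      have hu : ‖x / y‖ = 1 := by rw [norm_div, hxy, div_self hy']
      have h1 : ‖(x / y) ^ 2 - ε‖ = 1 := by
        refine le_antisymm ?_ (not_lt.mp fun h => hsq (isSquare_of_norm_sq_sub_lt hp hε hu h))
        rw [sub_eq_add_neg]
        refine (Padic.nonarchimedean _ _).trans (max_le ?_ ?_)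
        · rw [norm_pow, hu, one_pow]
        · rw [norm_neg, hε]
      have e : x ^ 2 - ε * y ^ 2 = ((x / y) ^ 2 - ε) * y ^ 2 := by field_simp
      rw [e, norm_mul, h1, norm_pow, hxy, max_self, one_mul]
  · have h : ‖x ^ 2‖ ≠ ‖ε * y ^ 2‖ := by
      rw [norm_mul, hε, one_mul, norm_pow, norm_pow]
      exact fun h => hxy ((pow_left_inj₀ (norm_nonneg _) (norm_nonneg _) two_ne_zero).mp h)
    rw [norm_sub_eq_max h, norm_mul, hε, one_mul, norm_pow, norm_pow]

theorem exists_norm_eq_zpow {x : ℚ_[p]} (hx : x ≠ 0) : ∃ v : ℤ, ‖x‖ = (p : ℝ) ^ v :=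
  ⟨_, Padic.norm_eq_zpow_neg_valuation hx⟩

/-- Norms of even and odd order cannot cancel. -/
theorem norm_sub_prime_mul {A B η a b : ℚ_[p]} (hη : ‖η‖ = (p : ℝ)⁻¹) (hA : ‖A‖ = ‖a‖ ^ 2)
    (hB : ‖B‖ = ‖b‖ ^ 2) : ‖A - η * B‖ = max ‖A‖ (‖η‖ * ‖B‖) := by
  have hp := cast_prime_pos (p := p)
  by_cases h : ‖A‖ = ‖η * B‖
  · have hA0 : A = 0 := by
      by_contra hA0
      have ha0 : a ≠ 0 := by rintro rfl; simp [hA0] at hA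
      have hb0 : b ≠ 0 := by
        rintro rfl
        rw [norm_mul, hB] at h
        simp [hA0] at h
      obtain ⟨v, hv⟩ := exists_norm_eq_zpow ha0
      obtain ⟨u, hu⟩ := exists_norm_eq_zpow hb0
      rw [norm_mul, hA, hB, hη, hv, hu, ← zpow_neg_one, ← zpow_natCast, ← zpow_natCast,
        ← zpow_mul, ← zpow_mul, ← zpow_add₀ hp.ne'] at h
      have := zpow_right_injective₀ hp cast_prime_one_lt.ne' h
      push_cast at this
      omega
    have hB0 : η * B = 0 := by rw [hA0, norm_zero] at h; exact norm_eq_zero.mp h.symm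
    rw [← norm_mul, hB0, hA0]; simp
  · rw [norm_sub_eq_max h, norm_mul]

theorem norm_mul_sq_le_iff {c : ℚ_[p]} {i : ℤ} (hc : ‖c‖ = (p : ℝ) ^ (-i)) (x : ℚ_[p]) (k : ℤ) :
    ‖c‖ * ‖x‖ ^ 2 ≤ (p : ℝ) ^ k ↔ ‖x‖ ≤ (p : ℝ) ^ ((k + i) / 2) := by
  have hp := cast_prime_pos (p := p)
  by_cases hx : x = 0
  · simp [hx, (zpow_pos hp _).le]
  · obtain ⟨v, hv⟩ := exists_norm_eq_zpow hx
    rw [hc, hv, ← zpow_natCast, ← zpow_mul, ← zpow_add₀ hp.ne',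
      zpow_le_zpow_iff_right₀ cast_prime_one_lt, zpow_le_zpow_iff_right₀ cast_prime_one_lt]
    push_cast
    omega

theorem volume_real_norm_mul_sq_le {n : ℕ} {c : Fin n → ℚ_[p]} {i : Fin n → ℤ}
    (hc : ∀ l, ‖c l‖ = (p : ℝ) ^ (-i l)) (k : ℤ) :
    volume.real {x : Fin n → ℚ_[p] | ∀ l, ‖c l‖ * ‖x l‖ ^ 2 ≤ (p : ℝ) ^ k} =
      (p : ℝ) ^ ∑ l, (k + i l) / 2 := by
  rw [← volume_real_pi_closedBall]
  simp_rw [fun l (x : Fin n → ℚ_[p]) => norm_mul_sq_le_iff (hc l) (x l) k]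

theorem not_isSquare_intCast {a : ℤ} (ha : ¬ IsSquare (a : ZMod p)) :
    ‖(a : ℚ_[p])‖ = 1 ∧ ¬ IsSquare (a : ℚ_[p]) := by
  have h1 : ‖(a : ℚ_[p])‖ = 1 := by
    refine le_antisymm (Padic.norm_int_le_one a) (not_lt.mp fun h => ha ?_)
    rw [Padic.norm_intCast_lt_one_iff, ← ZMod.intCast_zmod_eq_zero_iff_dvd] at h
    rw [h]; exact IsSquare.zero
  refine ⟨h1, ?_⟩
  rintro ⟨z, hz⟩
  have hz1 : ‖z‖ ≤ 1 := by
    rw [hz, norm_mul] at h1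
    nlinarith [norm_nonneg z]
  obtain ⟨y, rfl⟩ : ∃ y : ℤ_[p], (y : ℚ_[p]) = z := ⟨⟨z, hz1⟩, rfl⟩
  have h2 : (a : ℤ_[p]) = y * y := by
    apply Subtype.ext
    rw [PadicInt.coe_mul, PadicInt.coe_intCast]
    exact hz
  refine ha ⟨PadicInt.toZMod y, ?_⟩
  rw [← map_mul, ← h2, map_intCast]

theorem quadForm_ne_zero_of_norm_le_iff {n : ℕ} {c : Fin n → ℚ_[p]}
    (h : ∀ x r, ‖quadForm c x‖ ≤ r ↔ ∀ i, ‖c i‖ * ‖x i‖ ^ 2 ≤ r) (hc : ∀ i, c i ≠ 0)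
    {x : Fin n → ℚ_[p]} (hx : x ≠ 0) : quadForm c x ≠ 0 := by
  intro h0
  apply hx
  funext i
  have h1 := (h x 0).mp (by rw [h0, norm_zero]) i
  have h2 : 0 < ‖c i‖ := norm_pos_iff.mpr (hc i)
  have h3 : ‖x i‖ ^ 2 ≤ 0 := by
    by_contra h3
    exact absurd h1 (not_le.mpr (mul_pos h2 (not_le.mp h3)))
  have h4 : ‖x i‖ = 0 := by nlinarith [norm_nonneg (x i)]
  exact norm_eq_zero.mp h4

theorem isNormDiagonal_binary_unit (hp : p ≠ 2) {ε : ℚ_[p]} (hε : ‖ε‖ = 1)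
    (hsq : ¬ IsSquare ε) : IsNormDiagonal ![1, -ε] 2 1 := by
  have hN : ∀ x : Fin 2 → ℚ_[p], ‖quadForm ![1, -ε] x‖ = max (‖x 0‖ ^ 2) (‖x 1‖ ^ 2) := by
    intro x
    rw [← norm_sq_sub_unit_mul_sq hp hε hsq]
    simp [quadForm, Fin.sum_univ_two, sub_eq_add_neg]
  have hle : ∀ (x : Fin 2 → ℚ_[p]) r, ‖quadForm ![1, -ε] x‖ ≤ r ↔
      ∀ i, ‖(![1, -ε] : Fin 2 → ℚ_[p]) i‖ * ‖x i‖ ^ 2 ≤ r := by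
    intro x r
    rw [hN, Fin.forall_fin_two, max_le_iff]
    simp [hε]
  have hcoef : ∀ i, ‖(![1, -ε] : Fin 2 → ℚ_[p]) i‖ = 1 := by
    rw [Fin.forall_fin_two]; simp [hε]
  refine ⟨rfl, by norm_num, by norm_num, hle, fun i => Or.inl (hcoef i), fun x hx => ?_,
    fun j => ?_⟩
  · have h0 := quadForm_ne_zero_of_norm_le_iff hle
      (fun i => norm_ne_zero_iff.mp (by rw [hcoef]; norm_num)) hx
    obtain ⟨z, hz⟩ : ∃ z : ℚ_[p], ‖quadForm ![1, -ε] x‖ = ‖z‖ ^ 2 := by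
      rw [hN]
      rcases max_choice (‖x 0‖ ^ 2) (‖x 1‖ ^ 2) with h | h
      · exact ⟨_, h⟩
      · exact ⟨_, h⟩
    have hz0 : z ≠ 0 := by
      rintro rfl
      rw [norm_zero, zero_pow two_ne_zero, norm_eq_zero] at hz
      exact h0 hz
    obtain ⟨v, hv⟩ := exists_norm_eq_zpow hz0
    refine ⟨v, ?_⟩
    rw [hz, hv, ← zpow_natCast, ← zpow_natCast, ← zpow_mul, ← zpow_mul, mul_comm]
  · rw [← zpow_natCast, ← zpow_mul]
    simp_rw [hle]
    rw [volume_real_norm_mul_sq_le (i := fun _ => 0) (fun l => by rw [hcoef]; simp)]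
    congr 1
    rw [Fin.sum_univ_two]
    push_cast
    omega

theorem isNormDiagonal_binary_prime {η : ℚ_[p]} (hη : ‖η‖ = (p : ℝ)⁻¹) :
    IsNormDiagonal ![1, -η] 1 1 := by
  have hpp := cast_prime_pos (p := p)
  have hle : ∀ (x : Fin 2 → ℚ_[p]) r, ‖quadForm ![1, -η] x‖ ≤ r ↔
      ∀ i, ‖(![1, -η] : Fin 2 → ℚ_[p]) i‖ * ‖x i‖ ^ 2 ≤ r := by
    intro x r
    have := norm_sub_prime_mul hη (norm_pow (x 0) 2) (norm_pow (x 1) 2)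
    have e : quadForm ![1, -η] x = x 0 ^ 2 - η * x 1 ^ 2 := by
      simp [quadForm, Fin.sum_univ_two, sub_eq_add_neg]
    rw [e, this, Fin.forall_fin_two, max_le_iff]
    simp
  have hcoef : ∀ i, ‖(![1, -η] : Fin 2 → ℚ_[p]) i‖ = (p : ℝ) ^ (-(![0, 1] i : ℤ)) := by
    rw [Fin.forall_fin_two]; simp [hη]
  refine ⟨rfl, by norm_num, by norm_num, hle, ?_, fun x hx => ?_, fun j => ?_⟩
  · rw [Fin.forall_fin_two]; simp [hη]
  · obtain ⟨v, hv⟩ := exists_norm_eq_zpow (quadForm_ne_zero_of_norm_le_iff hle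
      (fun i => norm_ne_zero_iff.mp (by rw [hcoef]; positivity)) hx)
    exact ⟨v, by rw [hv, pow_one]⟩
  · simp_rw [hle, pow_one]
    rw [volume_real_norm_mul_sq_le hcoef, ← zpow_natCast, ← zpow_mul]
    congr 1
    rw [Fin.sum_univ_two]
    simp only [Matrix.cons_val_zero, Matrix.cons_val_one]
    push_cast
    omega

theorem isNormDiagonal_quaternary (hp : p ≠ 2) {ε : ℚ_[p]} (hε : ‖ε‖ = 1)
    (hsq : ¬ IsSquare ε) :
    IsNormDiagonal ![1, -ε, -(p : ℚ_[p]), ε * (p : ℚ_[p])] 1 2 := by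
  have hpp := cast_prime_pos (p := p)
  set c : Fin 4 → ℚ_[p] := ![1, -ε, -(p : ℚ_[p]), ε * (p : ℚ_[p])] with hc
  have hsqr : ∀ x y : ℚ_[p], ∃ z : ℚ_[p], ‖x ^ 2 - ε * y ^ 2‖ = ‖z‖ ^ 2 := by
    intro x y
    rw [norm_sq_sub_unit_mul_sq hp hε hsq]
    rcases max_choice (‖x‖ ^ 2) (‖y‖ ^ 2) with h | h
    · exact ⟨_, h⟩
    · exact ⟨_, h⟩
  have hle : ∀ (x : Fin 4 → ℚ_[p]) r, ‖quadForm c x‖ ≤ r ↔ ∀ i, ‖c i‖ * ‖x i‖ ^ 2 ≤ r := by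
    intro x r
    obtain ⟨z, hz⟩ := hsqr (x 0) (x 1)
    obtain ⟨z', hz'⟩ := hsqr (x 2) (x 3)
    have := norm_sub_prime_mul Padic.norm_p hz hz'
    have e : quadForm c x = (x 0 ^ 2 - ε * x 1 ^ 2) - p * (x 2 ^ 2 - ε * x 3 ^ 2) := by
      simp [quadForm, Fin.sum_univ_four, hc]
      ring
    rw [e, this, norm_sq_sub_unit_mul_sq hp hε hsq, norm_sq_sub_unit_mul_sq hp hε hsq,
      mul_max_of_nonneg _ _ (norm_nonneg _), max_le_iff, max_le_iff, max_le_iff]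
    constructor
    · rintro ⟨⟨h0, h1⟩, h2, h3⟩ i
      rw [Padic.norm_p] at h2 h3
      fin_cases i <;> simpa [hc, hε]
    · intro h
      have h0 := h 0
      have h1 := h 1
      have h2 := h 2
      have h3 := h 3
      simp only [hc] at h0 h1 h2 h3
      simp [hε] at h0 h1 h2 h3
      exact ⟨⟨h0, h1⟩, by simpa using h2, by simpa using h3⟩
  have hcoef : ∀ i, ‖c i‖ = (p : ℝ) ^ (-(![0, 0, 1, 1] i : ℤ)) := by
    intro i
    fin_cases i <;> simp [hc, hε]
  refine ⟨rfl, by norm_num, by norm_num, hle, ?_, fun x hx => ?_, fun j => ?_⟩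
  · intro i
    fin_cases i <;> simp [hc, hε]
  · obtain ⟨v, hv⟩ := exists_norm_eq_zpow (quadForm_ne_zero_of_norm_le_iff hle
      (fun i => norm_ne_zero_iff.mp (by rw [hcoef]; positivity)) hx)
    exact ⟨v, by rw [hv, pow_one]⟩
  · simp_rw [hle, pow_one]
    rw [volume_real_norm_mul_sq_le hcoef, ← zpow_natCast, ← zpow_mul]
    congr 1
    rw [Fin.sum_univ_four]
    simp
    omega

theorem IsRieszForm.isNormDiagonal (hp : p ≠ 2) {n : ℕ} {c : Fin n → ℚ_[p]} {e : ℕ}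
    (hc : IsRieszForm p n c e) : ∃ m, IsNormDiagonal c e m := by
  cases hc with
  | quaternary a ha =>
    obtain ⟨ha1, hsq⟩ := not_isSquare_intCast ha
    exact ⟨2, isNormDiagonal_quaternary hp ha1 hsq⟩
  | binary_unit ε hε hsq => exact ⟨1, isNormDiagonal_binary_unit hp hε hsq⟩
  | binary_prime => exact ⟨1, isNormDiagonal_binary_prime Padic.norm_p⟩
  | binary_unit_mul_prime ε hε hsq =>
    exact ⟨1, isNormDiagonal_binary_prime (by rw [norm_mul, hε, Padic.norm_p, one_mul])⟩

end Forms

/-! ### Lattices attached to the form and averages over them -/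

section Lattice

variable {p : ℕ} [Fact p.Prime] {n : ℕ} {c : Fin n → ℚ_[p]} {e m : ℕ}

/-- The lattice `{‖f‖ ≤ p ^ (e j)}`. -/
def lattice (c : Fin n → ℚ_[p]) (e : ℕ) (j : ℤ) : Set (Fin n → ℚ_[p]) :=
  {x | ‖quadForm c x‖ ≤ ((p : ℝ) ^ e) ^ j}

theorem mem_lattice {j : ℤ} {x : Fin n → ℚ_[p]} :
    x ∈ lattice c e j ↔ ‖quadForm c x‖ ≤ ((p : ℝ) ^ e) ^ j := Iff.rfl

theorem continuous_quadForm (c : Fin n → ℚ_[p]) : Continuous (quadForm c) := by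
  unfold quadForm; fun_prop

theorem isClosed_lattice (j : ℤ) : IsClosed (lattice c e j) :=
  isClosed_le (continuous_quadForm c).norm continuous_const

theorem measurableSet_lattice (j : ℤ) : MeasurableSet (lattice c e j) :=
  (isClosed_lattice j).measurableSet

theorem zero_mem_lattice (j : ℤ) : (0 : Fin n → ℚ_[p]) ∈ lattice c e j := by
  have := cast_prime_pos (p := p)
  rw [mem_lattice, quadForm]
  simp only [Pi.zero_apply, ne_eq, OfNat.ofNat_ne_zero, not_false_eq_true, zero_pow, mul_zero,
    Finset.sum_const_zero, norm_zero]
  positivity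

theorem neg_mem_lattice {j : ℤ} {x : Fin n → ℚ_[p]} (hx : x ∈ lattice c e j) :
    -x ∈ lattice c e j := by
  have : quadForm c (-x) = quadForm c x := by simp [quadForm]
  rwa [mem_lattice, this]

namespace IsNormDiagonal

theorem one_lt_base (hf : IsNormDiagonal c e m) : (1 : ℝ) < (p : ℝ) ^ e :=
  one_lt_pow₀ cast_prime_one_lt hf.exponent_pos.ne'

theorem one_lt_index (hf : IsNormDiagonal c e m) : (1 : ℝ) < (p : ℝ) ^ (e * m) :=
  one_lt_pow₀ cast_prime_one_lt (Nat.mul_pos hf.exponent_pos hf.dim_pos).ne'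

theorem lattice_mono (hf : IsNormDiagonal c e m) {i j : ℤ} (h : i ≤ j) :
    lattice c e i ⊆ lattice c e j := fun _ hx =>
  mem_lattice.mpr (hx.trans (zpow_le_zpow_right₀ hf.one_lt_base.le h))

theorem add_mem_lattice (hf : IsNormDiagonal c e m) {j : ℤ} {x y : Fin n → ℚ_[p]}
    (hx : x ∈ lattice c e j) (hy : y ∈ lattice c e j) : x + y ∈ lattice c e j := by
  rw [mem_lattice, hf.norm_le_iff] at *
  intro i
  have h : ‖(x + y) i‖ ≤ max ‖x i‖ ‖y i‖ := Padic.nonarchimedean _ _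
  rcases le_max_iff.mp h with h | h
  · exact (by gcongr : _ ≤ ‖c i‖ * ‖x i‖ ^ 2).trans (hx i)
  · exact (by gcongr : _ ≤ ‖c i‖ * ‖y i‖ ^ 2).trans (hy i)

theorem add_mem_lattice_iff (hf : IsNormDiagonal c e m) {j : ℤ} {x y : Fin n → ℚ_[p]}
    (hx : x ∈ lattice c e j) : x + y ∈ lattice c e j ↔ y ∈ lattice c e j := by
  refine ⟨fun h => ?_, hf.add_mem_lattice hx⟩
  have := hf.add_mem_lattice (neg_mem_lattice hx) h
  rwa [neg_add_cancel_left] at this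

theorem norm_sq_le (hf : IsNormDiagonal c e m) (x : Fin n → ℚ_[p]) :
    ‖x‖ ^ 2 ≤ p * ‖quadForm c x‖ := by
  have hp := cast_prime_pos (p := p)
  have h : ∀ i, ‖x i‖ ^ 2 ≤ p * ‖quadForm c x‖ := by
    intro i
    have h1 := (hf.norm_le_iff x _).mp le_rfl i
    have h2 : (p : ℝ)⁻¹ ≤ ‖c i‖ := by
      rcases hf.norm_coeff i with h | h
      · rw [h]; exact inv_le_one_of_one_le₀ cast_prime_one_lt.le
      · exact h.ge
    calc ‖x i‖ ^ 2 = p * ((p : ℝ)⁻¹ * ‖x i‖ ^ 2) := by field_simp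
      _ ≤ p * (‖c i‖ * ‖x i‖ ^ 2) := by gcongr
      _ ≤ _ := by gcongr
  have h0 : 0 ≤ (p : ℝ) * ‖quadForm c x‖ := by positivity
  rw [← Real.le_sqrt (norm_nonneg _) h0, pi_norm_le_iff_of_nonneg (Real.sqrt_nonneg _)]
  exact fun i => (Real.le_sqrt (norm_nonneg _) h0).mpr (h i)

theorem norm_quadForm_le (hf : IsNormDiagonal c e m) (x : Fin n → ℚ_[p]) :
    ‖quadForm c x‖ ≤ ‖x‖ ^ 2 := by
  rw [hf.norm_le_iff]
  intro i
  have h2 : ‖c i‖ ≤ 1 := by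
    rcases hf.norm_coeff i with h | h
    · exact h.le
    · rw [h]; exact inv_le_one_of_one_le₀ cast_prime_one_lt.le
  calc _ ≤ 1 * ‖x‖ ^ 2 := by gcongr; exact norm_le_pi_norm x i
    _ = _ := one_mul _

theorem quadForm_eq_zero_iff (hf : IsNormDiagonal c e m) {x : Fin n → ℚ_[p]} :
    quadForm c x = 0 ↔ x = 0 := by
  constructor
  · intro h
    have := hf.norm_sq_le x
    rw [h, norm_zero, mul_zero] at this
    have : ‖x‖ = 0 := by nlinarith [norm_nonneg x]
    exact norm_eq_zero.mp this
  · rintro rfl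
    simp [quadForm]

theorem exists_lattice_subset (hf : IsNormDiagonal c e m) (N : ℤ) :
    ∃ j, lattice c e j ⊆ Metric.closedBall 0 ((p : ℝ) ^ N) := by
  have hp := cast_prime_pos (p := p)
  refine ⟨-|2 * N - 1|, fun x hx => ?_⟩
  rw [mem_closedBall_zero_iff, ← pow_le_pow_iff_left₀ (norm_nonneg x) (zpow_nonneg hp.le N)
    two_ne_zero]
  have he : (1 : ℤ) ≤ e := by exact_mod_cast hf.exponent_pos
  have h1 : (e : ℤ) * -|2 * N - 1| ≤ 2 * N - 1 := by
    nlinarith [neg_abs_le (2 * N - 1), abs_nonneg (2 * N - 1)]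
  calc ‖x‖ ^ 2 ≤ p * ‖quadForm c x‖ := hf.norm_sq_le x
    _ ≤ p * ((p : ℝ) ^ e) ^ (-|2 * N - 1|) := by gcongr; exact hx
    _ = (p : ℝ) ^ (1 + (e : ℤ) * -|2 * N - 1|) := by
      rw [zpow_add₀ hp.ne', zpow_mul, zpow_one, zpow_natCast]
    _ ≤ (p : ℝ) ^ (N * (2 : ℕ)) := zpow_le_zpow_right₀ cast_prime_one_lt.le (by push_cast; linarith)
    _ = _ := by rw [zpow_mul, zpow_natCast]

theorem exists_subset_lattice (hf : IsNormDiagonal c e m) (M : ℤ) :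
    ∃ j, Metric.closedBall 0 ((p : ℝ) ^ M) ⊆ lattice c e j := by
  have hp := cast_prime_pos (p := p)
  refine ⟨|2 * M|, fun x hx => ?_⟩
  rw [mem_closedBall_zero_iff] at hx
  have he : (1 : ℤ) ≤ e := by exact_mod_cast hf.exponent_pos
  have h1 : 2 * M ≤ (e : ℤ) * |2 * M| := by
    nlinarith [le_abs_self (2 * M), abs_nonneg (2 * M)]
  calc ‖quadForm c x‖ ≤ ‖x‖ ^ 2 := hf.norm_quadForm_le x
    _ ≤ ((p : ℝ) ^ M) ^ 2 := by gcongr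
    _ = (p : ℝ) ^ (M * (2 : ℕ)) := by rw [zpow_mul, zpow_natCast]
    _ ≤ (p : ℝ) ^ ((e : ℤ) * |2 * M|) :=
      zpow_le_zpow_right₀ cast_prime_one_lt.le (by push_cast; linarith)
    _ = _ := by rw [zpow_mul, zpow_natCast]

theorem isCompact_lattice (hf : IsNormDiagonal c e m) (j : ℤ) : IsCompact (lattice c e j) := by
  have hw := zero_lt_one.trans hf.one_lt_base
  refine Metric.isCompact_of_isClosed_isBounded (isClosed_lattice j) ?_
  refine (Metric.isBounded_closedBall (x := 0)
    (r := Real.sqrt (p * ((p : ℝ) ^ e) ^ j))).subset fun x hx => ?_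
  rw [mem_closedBall_zero_iff]
  refine Real.le_sqrt_of_sq_le ((hf.norm_sq_le x).trans ?_)
  gcongr
  exact hx

theorem lattice_mem_nhds (hf : IsNormDiagonal c e m) (j : ℤ) : lattice c e j ∈ 𝓝 0 := by
  have hw := zero_lt_one.trans hf.one_lt_base
  have h : Tendsto (fun x => ‖quadForm c x‖) (𝓝 0) (𝓝 0) := by
    have := (continuous_quadForm c).norm.tendsto 0
    rwa [hf.quadForm_eq_zero_iff.mpr rfl, norm_zero] at this
  filter_upwards [h.eventually_lt_const (zpow_pos hw j)] with x hx
  exact hx.le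

theorem setIntegral_lattice_add (hf : IsNormDiagonal c e m) {j : ℤ} {b : Fin n → ℚ_[p]}
    (hb : b ∈ lattice c e j) (g : (Fin n → ℚ_[p]) → ℂ) :
    ∫ y in lattice c e j, g (b + y) = ∫ y in lattice c e j, g y := by
  rw [← integral_indicator (measurableSet_lattice j),
    ← integral_indicator (measurableSet_lattice j),
    ← integral_add_left_eq_self ((lattice c e j).indicator g) b]
  congr 1
  funext y
  by_cases hy : y ∈ lattice c e j
  · rw [Set.indicator_of_mem hy, Set.indicator_of_mem (hf.add_mem_lattice hb hy)]
  · rw [Set.indicator_of_notMem hy,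
      Set.indicator_of_notMem (fun h => hy ((hf.add_mem_lattice_iff hb).mp h))]

end IsNormDiagonal

/-- `φ` is invariant under the lattice of index `i` and supported in the lattice of index `j`. -/
def IsTestBetween (c : Fin n → ℚ_[p]) (e : ℕ) (i j : ℤ) (φ : (Fin n → ℚ_[p]) → ℂ) : Prop :=
  (∀ x, ∀ t ∈ lattice c e i, φ (x + t) = φ x) ∧ ∀ x ∉ lattice c e j, φ x = 0

theorem IsTestBetween.mono (hf : IsNormDiagonal c e m) {i j i' j' : ℤ}
    {φ : (Fin n → ℚ_[p]) → ℂ} (h : IsTestBetween c e i j φ) (hi : i' ≤ i) (hj : j ≤ j') :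
    IsTestBetween c e i' j' φ :=
  ⟨fun x t ht => h.1 x t (hf.lattice_mono hi ht),
    fun x hx => h.2 x fun hx' => hx (hf.lattice_mono hj hx')⟩

theorem IsNormDiagonal.mem_schwartz_iff (hf : IsNormDiagonal c e m) {φ : (Fin n → ℚ_[p]) → ℂ} :
    φ ∈ schwartz p n ↔ ∃ i j, IsTestBetween c e i j φ := by
  constructor
  · intro h
    obtain ⟨N, hN⟩ := exists_zpow_invariant h
    obtain ⟨M, hM⟩ := exists_zpow_support h
    obtain ⟨i, hi⟩ := hf.exists_lattice_subset N
    obtain ⟨j, hj⟩ := hf.exists_subset_lattice M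
    refine ⟨i, j, fun x t ht => hN x t (mem_closedBall_zero_iff.mp (hi ht)), fun x hx => hM x ?_⟩
    by_contra hx'
    exact hx (hj (mem_closedBall_zero_iff.mpr (not_lt.mp hx')))
  · rintro ⟨i, j, h1, h2⟩
    refine ⟨?_, HasCompactSupport.intro (hf.isCompact_lattice j) h2⟩
    rw [IsLocallyConstant.iff_eventually_eq]
    intro x
    have : Tendsto (fun y => y - x) (𝓝 x) (𝓝 0) := by
      have h : Continuous fun y => y - x := by fun_prop
      simpa using h.tendsto x
    filter_upwards [this (hf.lattice_mem_nhds i)] with y hy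
    have := h1 x (y - x) hy
    rwa [add_sub_cancel] at this

/-- The average `x ↦ p ^ (-e m j) ∫ φ(x + y) dy` over the lattice of index `j`. -/
def avg (c : Fin n → ℚ_[p]) (e m : ℕ) (j : ℤ) (φ : (Fin n → ℚ_[p]) → ℂ) (x : Fin n → ℚ_[p]) : ℂ :=
  (((p : ℂ) ^ (e * m)) ^ j)⁻¹ * ∫ y in lattice c e j, φ (x + y)

namespace IsNormDiagonal

theorem index_ne_zero (_ : IsNormDiagonal c e m) : (p : ℂ) ^ (e * m) ≠ 0 :=
  pow_ne_zero _ (by exact_mod_cast (Fact.out : p.Prime).ne_zero)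

theorem avg_add_of_mem (hf : IsNormDiagonal c e m) {j : ℤ} {b : Fin n → ℚ_[p]}
    (hb : b ∈ lattice c e j) (φ : (Fin n → ℚ_[p]) → ℂ) (x : Fin n → ℚ_[p]) :
    avg c e m j φ (x + b) = avg c e m j φ x := by
  unfold avg
  rw [← hf.setIntegral_lattice_add hb (fun y => φ (x + y))]
  simp_rw [add_assoc]

theorem avg_eq_self (hf : IsNormDiagonal c e m) {j : ℤ} {φ : (Fin n → ℚ_[p]) → ℂ}
    {x : Fin n → ℚ_[p]} (h : ∀ t ∈ lattice c e j, φ (x + t) = φ x) : avg c e m j φ x = φ x := by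
  unfold avg
  rw [setIntegral_congr_fun (measurableSet_lattice j) h, setIntegral_const, lattice,
    hf.volume_real, Complex.real_smul, ← mul_assoc]
  push_cast
  rw [inv_mul_cancel₀ (zpow_ne_zero _ hf.index_ne_zero), one_mul]

theorem avg_avg_comm (hf : IsNormDiagonal c e m) (i j : ℤ) {φ : (Fin n → ℚ_[p]) → ℂ}
    (h : Continuous φ) : avg c e m i (avg c e m j φ) = avg c e m j (avg c e m i φ) := by
  funext x
  unfold avg
  rw [integral_const_mul, integral_const_mul, mul_left_comm]
  congr 2
  rw [integral_integral_swap]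
  · simp_rw [add_right_comm]
  · rw [Measure.prod_restrict]
    refine ContinuousOn.integrableOn_compact
      ((hf.isCompact_lattice i).prod (hf.isCompact_lattice j)) (Continuous.continuousOn ?_)
    exact h.comp (by fun_prop)

theorem avg_avg_of_le (hf : IsNormDiagonal c e m) {i j : ℤ} (hij : i ≤ j)
    (φ : (Fin n → ℚ_[p]) → ℂ) : avg c e m i (avg c e m j φ) = avg c e m j φ := by
  funext x
  exact hf.avg_eq_self fun t ht => hf.avg_add_of_mem (hf.lattice_mono hij ht) φ x

theorem avg_avg_of_ge (hf : IsNormDiagonal c e m) {i j : ℤ} (hij : j ≤ i)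
    {φ : (Fin n → ℚ_[p]) → ℂ} (h : Continuous φ) :
    avg c e m i (avg c e m j φ) = avg c e m i φ := by
  rw [hf.avg_avg_comm i j h, hf.avg_avg_of_le hij]

theorem avg_of_le (hf : IsNormDiagonal c e m) {i j k : ℤ} {φ : (Fin n → ℚ_[p]) → ℂ}
    (h : IsTestBetween c e i j φ) (hk : k ≤ i) : avg c e m k φ = φ :=
  funext fun x => hf.avg_eq_self fun t ht => h.1 x t (hf.lattice_mono hk ht)

theorem avg_eq_zero_of_notMem (hf : IsNormDiagonal c e m) {i j k : ℤ} {φ : (Fin n → ℚ_[p]) → ℂ}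
    (h : IsTestBetween c e i j φ) (hk : j ≤ k) {x : Fin n → ℚ_[p]} (hx : x ∉ lattice c e k) :
    avg c e m k φ x = 0 := by
  unfold avg
  rw [setIntegral_congr_fun (g := fun _ => 0) (measurableSet_lattice k), integral_zero, mul_zero]
  intro y hy
  refine h.2 _ fun hxy => hx ?_
  rw [add_comm] at hxy
  exact (hf.add_mem_lattice_iff hy).mp (hf.lattice_mono hk hxy)

theorem avg_of_mem (hf : IsNormDiagonal c e m) {i j k : ℤ} {φ : (Fin n → ℚ_[p]) → ℂ}
    (h : IsTestBetween c e i j φ) (hk : j ≤ k) {x : Fin n → ℚ_[p]} (hx : x ∈ lattice c e k) :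
    avg c e m k φ x = (((p : ℂ) ^ (e * m)) ^ k)⁻¹ * ∫ y, φ y := by
  unfold avg
  rw [hf.setIntegral_lattice_add hx, setIntegral_eq_integral_of_forall_compl_eq_zero]
  exact fun y hy => h.2 y fun hy' => hy (hf.lattice_mono hk hy')

theorem avg_eq_zero (hf : IsNormDiagonal c e m) {i j k : ℤ} {φ : (Fin n → ℚ_[p]) → ℂ}
    (h : IsTestBetween c e i j φ) (h0 : ∫ y, φ y = 0) (hk : j ≤ k) : avg c e m k φ = 0 := by
  funext x
  by_cases hx : x ∈ lattice c e k
  · rw [hf.avg_of_mem h hk hx, h0, mul_zero]; rfl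
  · exact hf.avg_eq_zero_of_notMem h hk hx

theorem isTestBetween_avg (hf : IsNormDiagonal c e m) {i j : ℤ} {φ : (Fin n → ℚ_[p]) → ℂ}
    (h : IsTestBetween c e i j φ) (k : ℤ) :
    IsTestBetween c e i (max j k) (avg c e m k φ) := by
  constructor
  · intro x t ht
    unfold avg
    congr 2
    funext y
    rw [add_right_comm, h.1 _ t ht]
  · intro x hx
    unfold avg
    rw [setIntegral_congr_fun (g := fun _ => 0) (measurableSet_lattice k), integral_zero, mul_zero]
    intro y hy
    refine h.2 _ fun hxy => hx ?_
    rw [add_comm] at hxy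
    exact (hf.add_mem_lattice_iff (hf.lattice_mono (le_max_right j k) hy)).mp
      (hf.lattice_mono (le_max_left j k) hxy)

theorem avg_mem_schwartz (hf : IsNormDiagonal c e m) {φ : (Fin n → ℚ_[p]) → ℂ}
    (h : φ ∈ schwartz p n) (k : ℤ) : avg c e m k φ ∈ schwartz p n := by
  obtain ⟨i, j, hij⟩ := hf.mem_schwartz_iff.mp h
  exact hf.mem_schwartz_iff.mpr ⟨_, _, hf.isTestBetween_avg hij k⟩

theorem integral_avg (hf : IsNormDiagonal c e m) {φ : (Fin n → ℚ_[p]) → ℂ}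
    (h : φ ∈ schwartz p n) (k : ℤ) : ∫ x, avg c e m k φ x = ∫ x, φ x := by
  obtain ⟨i, j, hij⟩ := hf.mem_schwartz_iff.mp h
  have h1 := hf.avg_of_mem (hf.isTestBetween_avg hij k) le_rfl (zero_mem_lattice _)
  rw [hf.avg_avg_of_ge (le_max_right j k) h.1.continuous,
    hf.avg_of_mem hij (le_max_left j k) (zero_mem_lattice _)] at h1
  exact (mul_left_cancel₀ (inv_ne_zero (zpow_ne_zero _ hf.index_ne_zero)) h1).symm

theorem avg_add (hf : IsNormDiagonal c e m) {φ ψ : (Fin n → ℚ_[p]) → ℂ}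
    (h : Continuous φ) (h' : Continuous ψ) (k : ℤ) :
    avg c e m k (φ + ψ) = avg c e m k φ + avg c e m k ψ := by
  funext x
  simp only [avg, Pi.add_apply]
  rw [integral_add, mul_add]
  · exact (Continuous.continuousOn (by fun_prop)).integrableOn_compact (hf.isCompact_lattice k)
  · exact (Continuous.continuousOn (by fun_prop)).integrableOn_compact (hf.isCompact_lattice k)

end IsNormDiagonal

theorem avg_smul (a : ℂ) (φ : (Fin n → ℚ_[p]) → ℂ) (k : ℤ) :
    avg c e m k (a • φ) = a • avg c e m k φ := by
  funext x
  simp only [avg, Pi.smul_apply, smul_eq_mul]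
  rw [integral_const_mul, mul_left_comm]

/-- `avg` as an endomorphism of the space of test functions. -/
def avgMap (hf : IsNormDiagonal c e m) (k : ℤ) : schwartz p n →ₗ[ℂ] schwartz p n where
  toFun φ := ⟨avg c e m k φ.1, hf.avg_mem_schwartz φ.2 k⟩
  map_add' φ ψ := Subtype.ext (hf.avg_add φ.2.1.continuous ψ.2.1.continuous k)
  map_smul' a φ := Subtype.ext (avg_smul a φ.1 k)

theorem avg_translate (φ : schwartz p n) (k : ℤ) (x : Fin n → ℚ_[p]) :
    avg c e m k (translate φ x).1 0 = avg c e m k φ.1 x := by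
  simp [avg, translate]

end Lattice

/-! ### Multiplier kernels on the Lizorkin space and their convolution -/

section Kernel

variable {p : ℕ} [Fact p.Prime] {n : ℕ} {c : Fin n → ℚ_[p]} {e m : ℕ}

theorem avgMap_avgMap (hf : IsNormDiagonal c e m) (i j : ℤ) (φ : schwartz p n) :
    avgMap hf i (avgMap hf j φ) = avgMap hf (max i j) φ := by
  apply Subtype.ext
  rcases le_total i j with h | h
  · rw [max_eq_right h]; exact hf.avg_avg_of_le h φ.1
  · rw [max_eq_left h]; exact hf.avg_avg_of_ge h φ.2.1.continuous

/-- The detail of index `k`: the difference of the averages of index `k` and `k + 1`. In the Fourier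
picture it cuts out a shell of the dual lattices. -/
def detail (hf : IsNormDiagonal c e m) (k : ℤ) : schwartz p n →ₗ[ℂ] schwartz p n :=
  avgMap hf k - avgMap hf (k + 1)

theorem detail_apply (hf : IsNormDiagonal c e m) (k : ℤ) (φ : schwartz p n) (x : Fin n → ℚ_[p]) :
    (detail hf k φ).1 x = avg c e m k φ.1 x - avg c e m (k + 1) φ.1 x := rfl

theorem detail_detail (hf : IsNormDiagonal c e m) (i j : ℤ) (φ : schwartz p n) :
    detail hf i (detail hf j φ) = if i = j then detail hf j φ else 0 := by
  simp only [detail, LinearMap.sub_apply, map_sub, avgMap_avgMap]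
  rcases lt_trichotomy i j with h | rfl | h
  · rw [if_neg h.ne, max_eq_right h.le, max_eq_right (by omega : i + 1 ≤ j),
      max_eq_right (by omega : i ≤ j + 1), max_eq_right (by omega : i + 1 ≤ j + 1),
      sub_self, sub_self, sub_self]
  · rw [if_pos rfl, max_self, max_self, max_eq_left (by omega : i ≤ i + 1),
      max_eq_right (by omega : i ≤ i + 1), sub_self, sub_zero]
  · rw [if_neg h.ne', max_eq_left h.le, max_eq_left (by omega : j + 1 ≤ i),
      max_eq_left (by omega : j ≤ i + 1), max_eq_left (by omega : j + 1 ≤ i + 1), sub_self]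

theorem detail_mem (hf : IsNormDiagonal c e m) (k : ℤ) (φ : schwartz p n) :
    detail hf k φ ∈ lizorkinPhi p n := by
  rw [mem_lizorkinPhi_iff]
  simp only [detail_apply]
  rw [integral_sub, hf.integral_avg φ.2, hf.integral_avg φ.2, sub_self]
  · exact integrable_of_mem_schwartz (hf.avg_mem_schwartz φ.2 _)
  · exact integrable_of_mem_schwartz (hf.avg_mem_schwartz φ.2 _)

theorem detail_eq_zero_of_lt (hf : IsNormDiagonal c e m) {i j k : ℤ} {φ : schwartz p n}
    (h : IsTestBetween c e i j φ.1) (hk : k < i) : detail hf k φ = 0 := by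
  apply Subtype.ext
  funext x
  rw [detail_apply, hf.avg_of_le h hk.le, hf.avg_of_le h (by omega), sub_self]
  rfl

theorem detail_eq_zero_of_ge (hf : IsNormDiagonal c e m) {i j k : ℤ} {φ : schwartz p n}
    (hφ : φ ∈ lizorkinPhi p n) (h : IsTestBetween c e i j φ.1) (hk : j ≤ k) :
    detail hf k φ = 0 := by
  rw [mem_lizorkinPhi_iff] at hφ
  apply Subtype.ext
  funext x
  rw [detail_apply, hf.avg_eq_zero h hφ hk, hf.avg_eq_zero h hφ (by omega), sub_self]
  rfl

theorem exists_detail_eq_zero (hf : IsNormDiagonal c e m) (φ : lizorkinPhi p n) :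
    ∃ s : Finset ℤ, ∀ k ∉ s, detail hf k φ.1 = 0 := by
  obtain ⟨i, j, h⟩ := hf.mem_schwartz_iff.mp φ.1.2
  refine ⟨Finset.Ico i j, fun k hk => ?_⟩
  rw [Finset.mem_Ico, not_and_or, not_le, not_lt] at hk
  rcases hk with hk | hk
  · exact detail_eq_zero_of_lt hf h hk
  · exact detail_eq_zero_of_ge hf φ.2 h hk

theorem summable_detail (hf : IsNormDiagonal c e m) (t : ℂ) (φ : lizorkinPhi p n) :
    Summable fun k : ℤ => t ^ k * (detail hf k φ.1).1 0 := by
  obtain ⟨s, hs⟩ := exists_detail_eq_zero hf φ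
  refine summable_of_ne_finset_zero (s := s) fun k hk => ?_
  rw [hs k hk]
  exact mul_zero _

/-- The Lizorkin distribution whose Fourier multiplier is `t ^ k` on the shell cut out by the
detail of index `k`; the sum has finitely many nonzero terms on `Φ`. -/
def kernel (hf : IsNormDiagonal c e m) (t : ℂ) : LizorkinDistribution p n where
  toFun φ := ∑' k : ℤ, t ^ k * (detail hf k φ.1).1 0
  map_add' φ ψ := by
    rw [← (summable_detail hf t φ).tsum_add (summable_detail hf t ψ)]
    congr 1
    funext k
    rw [← mul_add, Submodule.coe_add, map_add]
    rfl
  map_smul' a φ := by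
    rw [RingHom.id_apply, smul_eq_mul, ← tsum_mul_left]
    congr 1
    funext k
    rw [Submodule.coe_smul, map_smul, mul_left_comm]
    rfl

theorem kernel_eq_sum (hf : IsNormDiagonal c e m) (t : ℂ) (φ : lizorkinPhi p n) {s : Finset ℤ}
    (hs : ∀ k ∉ s, (detail hf k φ.1).1 0 = 0) :
    kernel hf t φ = ∑ k ∈ s, t ^ k * (detail hf k φ.1).1 0 :=
  tsum_eq_sum fun k hk => by rw [hs k hk, mul_zero]

theorem translate_mem_lizorkinPhi {φ : schwartz p n} (hφ : φ ∈ lizorkinPhi p n)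
    (x : Fin n → ℚ_[p]) : translate φ x ∈ lizorkinPhi p n := by
  rw [mem_lizorkinPhi_iff] at hφ ⊢
  rw [← hφ]
  exact integral_add_left_eq_self φ.1 x

/-- Convolving multiplier kernels multiplies the multipliers: convolution with `kernel t` maps `φ`
to a member of `Φ`, so that the truncations are eventually inactive and the choice of the extensions
to `S` does not matter. -/
theorem isConvolution_kernel (hf : IsNormDiagonal c e m) (t u : ℂ) :
    IsConvolution (kernel hf t) (kernel hf u) (kernel hf (t * u)) := by
  intro T R hT hR φ
  obtain ⟨s, hs⟩ := exists_detail_eq_zero hf φ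
  set h : schwartz p n := ∑ k ∈ s, t ^ k • detail hf k φ.1 with hh
  have hmem : h ∈ lizorkinPhi p n :=
    Submodule.sum_mem _ fun k _ => Submodule.smul_mem _ _ (detail_mem hf k φ.1)
  have hval : ∀ x, T (translate φ.1 x) = h.1 x := by
    intro x
    have h1 : T (translate φ.1 x) = kernel hf t ⟨_, translate_mem_lizorkinPhi φ.2 x⟩ := by
      rw [← hT]; rfl
    have h2 : ∀ k, (detail hf k (translate φ.1 x)).1 0 = (detail hf k φ.1).1 x := by
      intro k
      rw [detail_apply, detail_apply, avg_translate, avg_translate]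
    rw [h1, kernel_eq_sum hf t _ (s := s) (fun k hk => by rw [h2, hs k hk]; rfl)]
    simp only [h2, hh]
    rw [AddSubmonoidClass.coe_finsetSum, Finset.sum_apply]
    rfl
  have htr : ∀ᶠ k : ℕ in atTop, truncated T φ.1 k = h := by
    obtain ⟨M, hM⟩ := exists_zpow_support h.2
    filter_upwards [eventually_ge_atTop M.toNat] with k hk
    apply Subtype.ext
    funext x
    change Set.indicator _ (fun x => T (translate φ.1 x)) x = h.1 x
    by_cases hx : x ∈ Metric.closedBall (0 : Fin n → ℚ_[p]) ((p : ℝ) ^ k)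
    · rw [Set.indicator_of_mem hx, hval]
    · rw [Set.indicator_of_notMem hx, hM x]
      rw [mem_closedBall_zero_iff, not_le] at hx
      refine lt_of_le_of_lt ?_ hx
      rw [← zpow_natCast]
      exact zpow_le_zpow_right₀ cast_prime_one_lt.le (by omega)
  have hdet : ∀ j, detail hf j h = if j ∈ s then t ^ j • detail hf j φ.1 else 0 := by
    intro j
    rw [hh, map_sum]
    simp only [map_smul, detail_detail, smul_ite, smul_zero]
    rw [Finset.sum_ite_eq]
  have hlim : R h = kernel hf (t * u) φ := by
    have h1 : R h = kernel hf u ⟨h, hmem⟩ := by rw [← hR]; rfl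
    rw [h1, kernel_eq_sum hf u _ (s := s), kernel_eq_sum hf (t * u) φ (s := s)]
    · refine Finset.sum_congr rfl fun j hj => ?_
      simp only [hdet, if_pos hj]
      change u ^ j * (t ^ j * _) = _
      rw [mul_zpow]
      ring
    · intro k hk
      rw [hs k hk]; rfl
    · intro k hk
      simp only [hdet, if_neg hk]; rfl
  exact tendsto_const_nhds.congr' (htr.mono fun k hk => by simp only [hk, hlim])

/-- The constant multiplier `1` gives the Dirac distribution, by telescoping. -/
theorem kernel_one (hf : IsNormDiagonal c e m) : kernel hf 1 = restrict (dirac p n) := by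
  ext φ
  obtain ⟨i, j, h⟩ := hf.mem_schwartz_iff.mp φ.1.2
  have hφ := (mem_lizorkinPhi_iff φ.1).mp φ.2
  set s : Finset ℤ := (Finset.range (j - i).toNat).image fun l : ℕ => i + l with hs
  rw [kernel_eq_sum hf 1 φ (s := s), hs, Finset.sum_image (by simp)]
  · simp only [one_zpow, one_mul, detail_apply]
    have := Finset.sum_range_sub' (fun l : ℕ => avg c e m (i + l) φ.1.1 0) (j - i).toNat
    simp only [Nat.cast_add, Nat.cast_one, ← add_assoc] at this
    rw [this, hf.avg_of_le h (by simp), hf.avg_eq_zero h hφ (by omega)]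
    simp [restrict, dirac]
  · intro k hk
    have : k < i ∨ j ≤ k := by
      by_contra! hc
      refine hk (Finset.mem_image.mpr ⟨(k - i).toNat, ?_, ?_⟩)
      · rw [Finset.mem_range]; omega
      · omega
    rcases this with hk | hk
    · rw [detail_eq_zero_of_lt hf h hk]; rfl
    · rw [detail_eq_zero_of_ge hf φ.2 h hk]; rfl

end Kernel

/-! ### The group of kernels -/

section Group

variable {p : ℕ} [Fact p.Prime] {n : ℕ}

theorem IsConvolution.unique {J L H H' : LizorkinDistribution p n} (h : IsConvolution J L H)
    (h' : IsConvolution J L H') : H = H' := by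
  obtain ⟨T, hT⟩ := LinearMap.exists_extend J
  obtain ⟨R, hR⟩ := LinearMap.exists_extend L
  ext φ
  exact tendsto_nhds_unique (h T R hT hR φ) (h' T R hT hR φ)

/-- A family with `K α ∗ K β = K (α + β)` is an abelian group under convolution. The product is
defined by choosing parameters, and uniqueness of convolutions shows that the choice is
immaterial. -/
theorem exists_commGroup_range {K : ℂ → LizorkinDistribution p n}
    (hK : ∀ α β, IsConvolution (K α) (K β) (K (α + β))) :
    ∃ _ : CommGroup (Set.range K),
      (∀ J L : Set.range K, IsConvolution J.1 L.1 (J * L).1) ∧ (1 : Set.range K).1 = K 0 := by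
  have hcongr : ∀ {α α' β β'}, K α = K α' → K β = K β' → K (α + β) = K (α' + β') := by
    intro α α' β β' h1 h2
    refine (hK α β).unique ?_
    rw [h1, h2]
    exact hK α' β'
  let param : Set.range K → ℂ := fun J => J.2.choose
  have hparam : ∀ J, K (param J) = J.1 := fun J => J.2.choose_spec
  let mk : ℂ → Set.range K := fun α => ⟨K α, α, rfl⟩
  let instMul : Mul (Set.range K) := ⟨fun J L => mk (param J + param L)⟩
  let instOne : One (Set.range K) := ⟨mk 0⟩
  let instInv : Inv (Set.range K) := ⟨fun J => mk (-param J)⟩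
  have hmul : ∀ J L : Set.range K, (J * L).1 = K (param J + param L) := fun _ _ => rfl
  have hone : (1 : Set.range K).1 = K 0 := rfl
  have hinv : ∀ J : Set.range K, (J⁻¹).1 = K (-param J) := fun _ => rfl
  let G : Group (Set.range K) := Group.ofLeftAxioms
    (fun J L M => by
      apply Subtype.ext
      rw [hmul, hmul]
      calc _ = K (param J + param L + param M) := hcongr (by rw [hparam, hmul]) rfl
        _ = K (param J + (param L + param M)) := by rw [add_assoc]
        _ = _ := hcongr rfl (by rw [hparam, hmul]))
    (fun J => by
      apply Subtype.ext
      rw [hmul]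
      calc _ = K (0 + param J) := hcongr (by rw [hparam, hone]) rfl
        _ = _ := by rw [zero_add, hparam])
    (fun J => by
      apply Subtype.ext
      rw [hmul, hone]
      calc _ = K (-param J + param J) := hcongr (by rw [hparam, hinv]) rfl
        _ = _ := by rw [neg_add_cancel])
  refine ⟨{ G with mul_comm := fun J L => ?_ }, fun J L => ?_, rfl⟩
  · apply Subtype.ext
    change K (param J + param L) = K (param L + param J)
    rw [add_comm]
  · have := hK (param J) (param L)
    rw [hparam, hparam] at this
    exact this

end Group

/-! ### Integration over shells -/

section Shell

variable {p : ℕ} [Fact p.Prime] {n : ℕ} {c : Fin n → ℚ_[p]} {e m : ℕ}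

/-- The shell `{‖f‖ = p ^ (e j)}`. -/
def shell (c : Fin n → ℚ_[p]) (e : ℕ) (j : ℤ) : Set (Fin n → ℚ_[p]) :=
  lattice c e j \ lattice c e (j - 1)

theorem measurableSet_shell (j : ℤ) : MeasurableSet (shell c e j) :=
  (measurableSet_lattice j).diff (measurableSet_lattice (j - 1))

theorem mem_shell_iff (hf : IsNormDiagonal c e m) {j : ℤ} {x : Fin n → ℚ_[p]} :
    x ∈ shell c e j ↔ ‖quadForm c x‖ = ((p : ℝ) ^ e) ^ j := by
  have hw := hf.one_lt_base
  constructor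
  · rintro ⟨h1, h2⟩
    have hx : x ≠ 0 := by rintro rfl; exact h2 (zero_mem_lattice _)
    obtain ⟨l, hl⟩ := hf.exists_zpow x hx
    rw [mem_lattice, hl, zpow_le_zpow_iff_right₀ hw] at h1 h2
    rw [hl, show l = j by omega]
  · intro h
    refine ⟨h.le, fun h2 => ?_⟩
    rw [mem_lattice, h, zpow_le_zpow_iff_right₀ hw] at h2
    omega

theorem iUnion_shell (hf : IsNormDiagonal c e m) :
    ⋃ j, shell c e j = {x | quadForm c x ≠ 0} := by
  have hw := zero_lt_one.trans hf.one_lt_base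
  ext x
  rw [Set.mem_iUnion, Set.mem_ofPred_eq]
  constructor
  · rintro ⟨j, hj⟩
    rw [mem_shell_iff hf] at hj
    exact norm_ne_zero_iff.mp (by rw [hj]; exact (zpow_pos hw j).ne')
  · intro hx
    obtain ⟨j, hj⟩ := hf.exists_zpow x (fun h => hx (hf.quadForm_eq_zero_iff.mpr h))
    exact ⟨j, (mem_shell_iff hf).mpr hj⟩

theorem pairwise_disjoint_shell (hf : IsNormDiagonal c e m) :
    Pairwise (Function.onFun Disjoint (shell c e)) := by
  intro i j hij
  rw [Function.onFun, Set.disjoint_left]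
  intro x hi hj
  rw [mem_shell_iff hf] at hi hj
  exact hij (zpow_right_injective₀ (zero_lt_one.trans hf.one_lt_base) hf.one_lt_base.ne'
    (hi.symm.trans hj))

/-- The integral over the shell of index `j`, divided by the volume of the lattice of index `j`. -/
def shellMean (c : Fin n → ℚ_[p]) (e m : ℕ) (j : ℤ) (φ : (Fin n → ℚ_[p]) → ℂ) : ℂ :=
  avg c e m j φ 0 - ((p : ℂ) ^ (e * m))⁻¹ * avg c e m (j - 1) φ 0

theorem setIntegral_lattice (hf : IsNormDiagonal c e m) (j : ℤ) (φ : (Fin n → ℚ_[p]) → ℂ) :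
    ∫ x in lattice c e j, φ x = ((p : ℂ) ^ (e * m)) ^ j * avg c e m j φ 0 := by
  simp only [avg, zero_add]
  rw [mul_inv_cancel_left₀ (zpow_ne_zero _ hf.index_ne_zero)]

theorem integrableOn_lattice (hf : IsNormDiagonal c e m) (j : ℤ) {φ : (Fin n → ℚ_[p]) → ℂ}
    (h : Continuous φ) : IntegrableOn φ (lattice c e j) :=
  h.continuousOn.integrableOn_compact (hf.isCompact_lattice j)

theorem setIntegral_shell (hf : IsNormDiagonal c e m) (j : ℤ) {φ : (Fin n → ℚ_[p]) → ℂ}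
    (h : Continuous φ) :
    ∫ x in shell c e j, φ x = ((p : ℂ) ^ (e * m)) ^ j * shellMean c e m j φ := by
  have hq := hf.index_ne_zero
  rw [shell, setIntegral_sdiff (measurableSet_lattice _) (integrableOn_lattice hf j h)
    (hf.lattice_mono (by omega)), setIntegral_lattice hf, setIntegral_lattice hf, shellMean,
    zpow_sub_one₀ hq]
  ring

theorem norm_setIntegral_lattice_le (hf : IsNormDiagonal c e m) {φ : (Fin n → ℚ_[p]) → ℂ} {C : ℝ}
    (hC : ∀ x, ‖φ x‖ ≤ C) (j : ℤ) :
    ‖∫ x in lattice c e j, φ x‖ ≤ C * ((p : ℝ) ^ (e * m)) ^ j := by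
  have := norm_setIntegral_le_of_norm_le_const (μ := volume) (f := φ)
    (hf.isCompact_lattice j).measure_lt_top (fun x _ => hC x)
  rwa [lattice, hf.volume_real] at this

theorem exists_norm_le {φ : (Fin n → ℚ_[p]) → ℂ} (h : φ ∈ schwartz p n) : ∃ C, ∀ x, ‖φ x‖ ≤ C :=
  h.2.exists_bound_of_continuous h.1.continuous

theorem hasSum_comp_add_int {h : ℤ → ℂ} {a : ℂ} (H : HasSum h a) (l : ℤ) :
    HasSum (fun k => h (k + l)) a :=
  (Equiv.hasSum_iff (Equiv.addRight l)).mpr H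

theorem summable_int_of_eq_zero {E : Type*} [AddCommGroup E] [TopologicalSpace E]
    [IsTopologicalAddGroup E] {h : ℤ → E} {J : ℤ} (h0 : ∀ j ≥ J, h j = 0)
    (hs : Summable fun k : ℕ => h (-k)) : Summable h :=
  Summable.of_nat_of_neg (summable_of_ne_finset_zero (s := Finset.range J.toNat) fun k hk =>
    h0 _ (by rw [Finset.mem_range] at hk; omega)) hs

/-- Integration of a function of `‖f‖` against a test function, shell by shell. -/
theorem hasSum_setIntegral_shell (hf : IsNormDiagonal c e m) {g : ℤ → ℂ}
    (hg : Summable fun k : ℕ => ‖g (-k)‖ * ((p : ℝ) ^ (e * m)) ^ (-(k : ℤ)))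
    {G : (Fin n → ℚ_[p]) → ℂ} (hG : ∀ x (j : ℤ), ‖quadForm c x‖ = ((p : ℝ) ^ e) ^ j → G x = g j)
    {φ : (Fin n → ℚ_[p]) → ℂ} (h : φ ∈ schwartz p n) :
    IntegrableOn (fun x => G x * φ x) {x | quadForm c x ≠ 0} ∧
      HasSum (fun j => g j * (((p : ℂ) ^ (e * m)) ^ j * shellMean c e m j φ))
        (∫ x in {x | quadForm c x ≠ 0}, G x * φ x) := by
  obtain ⟨C, hC⟩ := exists_norm_le h
  obtain ⟨i, J, hJ⟩ := hf.mem_schwartz_iff.mp h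
  have hcont := h.1.continuous
  have hcongr : ∀ j, Set.EqOn (fun x => G x * φ x) (fun x => g j * φ x) (shell c e j) :=
    fun j x hx => by simp only [hG x j ((mem_shell_iff hf).mp hx)]
  have hshell : ∀ j, IntegrableOn (fun x => g j * φ x) (shell c e j) := fun j =>
    (integrableOn_lattice hf j (by fun_prop)).mono_set Set.sdiff_subset
  have hint : IntegrableOn (fun x => G x * φ x) (⋃ j, shell c e j) := by
    refine integrableOn_iUnion_of_summable_integral_norm
      (fun j => (hshell j).congr_fun (hcongr j).symm (measurableSet_shell j)) ?_
    have hnorm : ∀ j, ∫ x in shell c e j, ‖G x * φ x‖ = ∫ x in shell c e j, ‖g j * φ x‖ :=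
      fun j => setIntegral_congr_fun (measurableSet_shell j) fun x hx => by
        simp only [hcongr j hx]
    simp_rw [hnorm]
    refine summable_int_of_eq_zero (J := J + 1) (fun j hj => ?_) ?_
    · rw [setIntegral_congr_fun (g := fun _ => (0 : ℝ)) (measurableSet_shell j), integral_zero]
      intro x hx
      have : φ x = 0 := hJ.2 x fun hx' => hx.2 (hf.lattice_mono (by omega) hx')
      simp [this]
    · refine Summable.of_nonneg_of_le (fun k => integral_nonneg fun x => norm_nonneg _)
        (fun k => ?_) (hg.mul_left C)
      calc ∫ x in shell c e (-k), ‖g (-k) * φ x‖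
          ≤ ∫ x in lattice c e (-k), ‖g (-k) * φ x‖ := by
            refine setIntegral_mono_set (integrableOn_lattice hf _ (by fun_prop)).norm
              (Eventually.of_forall fun x => norm_nonneg _) ?_
            exact LE.le.eventuallyLE Set.sdiff_subset
        _ ≤ ∫ x in lattice c e (-k), ‖g (-k)‖ * C := by
            refine setIntegral_mono (integrableOn_lattice hf _ (by fun_prop)).norm
              (integrableOn_const (hf.isCompact_lattice _).measure_lt_top.ne) fun x => ?_
            simp only [norm_mul]
            gcongr
            exact hC x
        _ = C * (‖g (-k)‖ * ((p : ℝ) ^ (e * m)) ^ (-(k : ℤ))) := by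
            rw [setIntegral_const, lattice, hf.volume_real, smul_eq_mul]
            ring
  have hsum := hasSum_integral_iUnion measurableSet_shell (pairwise_disjoint_shell hf) hint
  rw [iUnion_shell hf] at hint hsum
  refine ⟨hint, ?_⟩
  refine hsum.congr_fun fun j => ?_
  rw [setIntegral_congr_fun (measurableSet_shell j) (hcongr j), integral_const_mul,
    setIntegral_shell hf j hcont]

end Shell

/-! ### Regularization of the power kernels -/

section Regularization

variable {p : ℕ} [Fact p.Prime] {n : ℕ} {c : Fin n → ℚ_[p]} {e m : ℕ}

theorem shellMean_sub_shellMean (hf : IsNormDiagonal c e m) (k : ℤ) (φ : schwartz p n) :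
    shellMean c e m k φ.1 - shellMean c e m (k + 1) φ.1 =
      (detail hf k φ).1 0 - ((p : ℂ) ^ (e * m))⁻¹ * (detail hf (k - 1) φ).1 0 := by
  rw [detail_apply, detail_apply, shellMean, shellMean, sub_add_cancel, add_sub_cancel_right]
  ring

/-- The differences of shell means have finite support on all of `S`: beyond the support of `φ`
the details decay exactly like a geometric sequence with ratio the inverse lattice index. -/
theorem exists_shellMean_sub_eq_zero (hf : IsNormDiagonal c e m) (φ : schwartz p n) :
    ∃ s : Finset ℤ, ∀ k ∉ s, shellMean c e m k φ.1 - shellMean c e m (k + 1) φ.1 = 0 := by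
  have hq := hf.index_ne_zero
  obtain ⟨i, j, h⟩ := hf.mem_schwartz_iff.mp φ.2
  refine ⟨Finset.Icc i j, fun k hk => ?_⟩
  rw [Finset.mem_Icc, not_and_or, not_le, not_le] at hk
  rcases hk with hk | hk
  · rw [shellMean_sub_shellMean hf, detail_eq_zero_of_lt hf h hk,
      detail_eq_zero_of_lt hf h (by omega)]
    simp
  · rw [shellMean, shellMean, hf.avg_of_mem h (by omega) (zero_mem_lattice _),
      hf.avg_of_mem h (by omega) (zero_mem_lattice _),
      hf.avg_of_mem h (by omega) (zero_mem_lattice _),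
      hf.avg_of_mem h (by omega) (zero_mem_lattice _),
      add_sub_cancel_right, zpow_sub_one₀ hq, zpow_add_one₀ hq]
    field_simp
    ring

theorem summable_shellMean_sub (hf : IsNormDiagonal c e m) (t : ℂ) (φ : schwartz p n) :
    Summable fun k : ℤ => t ^ k * (shellMean c e m k φ.1 - shellMean c e m (k + 1) φ.1) := by
  obtain ⟨s, hs⟩ := exists_shellMean_sub_eq_zero hf φ
  refine summable_of_ne_finset_zero (s := s) fun k hk => ?_
  rw [hs k hk, mul_zero]

/-- The regularized power kernel: `(1 - t⁻¹) ∑ t ^ k b_k`, with `b_k` the shell means, after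
summation by parts. The resulting sum is finite, so it makes sense for all `t`. -/
def regularized (hf : IsNormDiagonal c e m) (t : ℂ) : Distribution p n where
  toFun φ := ∑' k : ℤ, t ^ k * (shellMean c e m k φ.1 - shellMean c e m (k + 1) φ.1)
  map_add' φ ψ := by
    rw [← (summable_shellMean_sub hf t φ).tsum_add (summable_shellMean_sub hf t ψ)]
    congr 1
    funext k
    rw [shellMean_sub_shellMean hf, shellMean_sub_shellMean hf, shellMean_sub_shellMean hf,
      map_add, map_add, Submodule.coe_add, Submodule.coe_add, Pi.add_apply, Pi.add_apply]
    ring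
  map_smul' a φ := by
    rw [RingHom.id_apply, smul_eq_mul, ← tsum_mul_left]
    congr 1
    funext k
    rw [shellMean_sub_shellMean hf, shellMean_sub_shellMean hf, map_smul, map_smul,
      Submodule.coe_smul, Submodule.coe_smul, Pi.smul_apply, Pi.smul_apply, smul_eq_mul,
      smul_eq_mul]
    ring

theorem regularized_apply (hf : IsNormDiagonal c e m) (t : ℂ) (φ : schwartz p n) :
    regularized hf t φ =
      ∑' k : ℤ, t ^ k * (shellMean c e m k φ.1 - shellMean c e m (k + 1) φ.1) := rfl

theorem hasSum_kernel (hf : IsNormDiagonal c e m) (t : ℂ) (φ : lizorkinPhi p n) :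
    HasSum (fun k : ℤ => t ^ k * (detail hf k φ.1).1 0) (kernel hf t φ) :=
  (summable_detail hf t φ).hasSum

theorem restrict_regularized (hf : IsNormDiagonal c e m) {t : ℂ} (ht : t ≠ 0) :
    restrict (regularized hf t) = (1 - t / (p : ℂ) ^ (e * m)) • kernel hf t := by
  ext φ
  have h1 := hasSum_kernel hf t φ
  have h2 := (hasSum_comp_add_int h1 (-1)).mul_left (t * ((p : ℂ) ^ (e * m))⁻¹)
  have h3 := h1.sub h2
  have h4 : restrict (regularized hf t) φ =
      kernel hf t φ - t * ((p : ℂ) ^ (e * m))⁻¹ * kernel hf t φ := by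
    rw [← h3.tsum_eq]
    change regularized hf t φ.1 = _
    rw [regularized_apply]
    congr 1
    funext k
    rw [shellMean_sub_shellMean hf, ← sub_eq_add_neg, zpow_sub_one₀ ht]
    field_simp
  rw [h4, LinearMap.smul_apply, smul_eq_mul]
  ring

/-- In the domain of absolute convergence, summation by parts over the shells. -/
theorem integral_power_kernel (hf : IsNormDiagonal c e m) {t : ℂ} (ht : 1 < ‖t‖)
    {G : (Fin n → ℚ_[p]) → ℂ}
    (hG : ∀ x (j : ℤ), ‖quadForm c x‖ = ((p : ℝ) ^ e) ^ j → G x = (t / (p : ℂ) ^ (e * m)) ^ j)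
    (φ : schwartz p n) :
    IntegrableOn (fun x => G x * φ.1 x) {x | quadForm c x ≠ 0} ∧
      regularized hf t φ = (1 - t⁻¹) * ∫ x in {x | quadForm c x ≠ 0}, G x * φ.1 x := by
  have hq := hf.index_ne_zero
  have ht0 : t ≠ 0 := by rintro rfl; simp at ht; linarith
  have hqr := zero_lt_one.trans hf.one_lt_index
  obtain ⟨hint, hsum⟩ := hasSum_setIntegral_shell hf (g := fun j => (t / (p : ℂ) ^ (e * m)) ^ j)
    (by
      have : Summable fun k : ℕ => (‖t‖⁻¹) ^ k :=
        summable_geometric_of_lt_one (by positivity) (inv_lt_one_of_one_lt₀ ht)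
      refine this.congr fun k => ?_
      rw [norm_zpow, norm_div, norm_pow, Complex.norm_natCast, div_zpow,
        div_mul_cancel₀ _ (zpow_ne_zero _ hqr.ne'), zpow_neg, zpow_natCast, inv_pow]) hG φ.2
  refine ⟨hint, ?_⟩
  have h1 : HasSum (fun j : ℤ => t ^ j * shellMean c e m j φ.1)
      (∫ x in {x | quadForm c x ≠ 0}, G x * φ.1 x) := by
    refine hsum.congr_fun fun j => ?_
    rw [div_zpow, ← mul_assoc, div_mul_cancel₀ _ (zpow_ne_zero _ hq)]
  have h2 := h1.sub ((hasSum_comp_add_int h1 1).mul_left t⁻¹)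
  rw [regularized_apply, sub_mul, one_mul, ← h2.tsum_eq]
  congr 1
  funext k
  rw [zpow_add_one₀ ht0]
  field_simp

/-- At the exceptional parameters the multiplier kernel is logarithmic. -/
theorem integral_log_kernel (hf : IsNormDiagonal c e m) :
    (∀ φ : schwartz p n, IntegrableOn (fun x => (Real.log ‖quadForm c x‖ : ℂ) * φ.1 x)
      {x | quadForm c x ≠ 0}) ∧
    ∀ φ : lizorkinPhi p n, kernel hf ((p : ℂ) ^ (e * m)) φ =
      -((1 - ((p : ℂ) ^ (e * m))⁻¹) / (e * Real.log p)) *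
        ∫ x in {x | quadForm c x ≠ 0}, (Real.log ‖quadForm c x‖ : ℂ) * φ.1.1 x := by
  have hp := cast_prime_pos (p := p)
  have hq := hf.index_ne_zero
  have hqr := hf.one_lt_index
  have hlog : (Real.log p : ℂ) ≠ 0 := by
    exact_mod_cast (Real.log_pos (cast_prime_one_lt (p := p))).ne'
  have he : (e : ℂ) ≠ 0 := by exact_mod_cast hf.exponent_pos.ne'
  have hlin : Summable fun k : ℕ => (k : ℝ) * ((p : ℝ) ^ (e * m)) ^ (-(k : ℤ)) := by
    have := summable_pow_mul_geometric_of_norm_lt_one 1 (r := ((p : ℝ) ^ (e * m))⁻¹) (by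
      rw [norm_inv, Real.norm_of_nonneg (by positivity)]
      exact inv_lt_one_of_one_lt₀ hqr)
    refine this.congr fun k => ?_
    rw [pow_one, zpow_neg, zpow_natCast, inv_pow]
  have hmain := fun (φ : schwartz p n) => hasSum_setIntegral_shell hf
    (g := fun j : ℤ => (j : ℂ) * (e * Real.log p))
    (G := fun x => (Real.log ‖quadForm c x‖ : ℂ)) (by
      refine (hlin.mul_left ‖((e : ℂ) * Real.log p)‖).congr fun k => ?_
      rw [norm_mul ((-(k : ℤ) : ℤ) : ℂ), show ‖((-(k : ℤ) : ℤ) : ℂ)‖ = k by simp]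
      ring) (by
      intro x j hx
      simp only [hx, Real.log_zpow, Real.log_pow]
      push_cast
      ring) φ.2
  refine ⟨fun φ => (hmain φ).1, fun φ => ?_⟩
  have hsum := (hmain φ.1).2
  obtain ⟨C, hC⟩ := exists_norm_le φ.1.2
  obtain ⟨i, J, hJ⟩ := hf.mem_schwartz_iff.mp φ.1.2
  have hφ := (mem_lizorkinPhi_iff φ.1).mp φ.2
  -- `I j` is the integral over the lattice of index `j`; it vanishes for large `j`.
  set I : ℤ → ℂ := fun j => ((p : ℂ) ^ (e * m)) ^ j * avg c e m j φ.1.1 0 with hI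
  have hI0 : ∀ j ≥ J, I j = 0 := fun j hj => by
    simp only [hI, hf.avg_eq_zero hJ hφ hj]; simp
  have hIle : ∀ j, ‖I j‖ ≤ C * ((p : ℝ) ^ (e * m)) ^ j := fun j => by
    simp only [hI, ← setIntegral_lattice hf]
    exact norm_setIntegral_lattice_le hf hC j
  have hs1 : Summable I := by
    refine summable_int_of_eq_zero hI0 ?_
    have : Summable fun k : ℕ => C * (((p : ℝ) ^ (e * m))⁻¹) ^ k :=
      (summable_geometric_of_lt_one (by positivity) (inv_lt_one_of_one_lt₀ hqr)).mul_left C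
    refine Summable.of_norm_bounded this fun k => (hIle _).trans (le_of_eq ?_)
    rw [zpow_neg, zpow_natCast, inv_pow]
  have hs2 : Summable fun j : ℤ => (j : ℂ) * I j := by
    refine summable_int_of_eq_zero (J := J) (fun j hj => by rw [hI0 j hj, mul_zero]) ?_
    refine Summable.of_norm_bounded (hlin.mul_left C) fun k => ?_
    rw [norm_mul]
    have h1 : ‖((-(k : ℤ) : ℤ) : ℂ)‖ = k := by simp
    rw [h1]
    calc (k : ℝ) * ‖I (-k)‖ ≤ k * (C * ((p : ℝ) ^ (e * m)) ^ (-(k : ℤ))) := by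
          gcongr; exact hIle _
      _ = _ := by ring
  -- summation by parts: `∑ j (I j - I (j - 1)) = -∑ I (j - 1)`
  have h1 : HasSum (fun j : ℤ => (j : ℂ) * (I j - I (j - 1))) (-∑' j, I j) := by
    have := (hs2.hasSum.sub (hasSum_comp_add_int hs2.hasSum (-1))).sub
      (hasSum_comp_add_int hs1.hasSum (-1))
    rw [sub_self, zero_sub] at this
    refine this.congr_fun fun j => ?_
    rw [← sub_eq_add_neg, Int.cast_sub, Int.cast_one]
    ring
  have h2 : ∫ x in {x | quadForm c x ≠ 0}, (Real.log ‖quadForm c x‖ : ℂ) * φ.1.1 x =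
      (e * Real.log p) * -∑' j, I j := by
    refine hsum.unique ?_
    refine (h1.mul_left ((e : ℂ) * Real.log p)).congr_fun fun j => ?_
    simp only [hI, shellMean, zpow_sub_one₀ hq]
    ring
  have h3 : kernel hf ((p : ℂ) ^ (e * m)) φ =
      ∑' j, I j - ((p : ℂ) ^ (e * m))⁻¹ * ∑' j, I j := by
    refine (hasSum_kernel hf _ φ).unique ?_
    refine (hs1.hasSum.sub
      ((hasSum_comp_add_int hs1.hasSum 1).mul_left ((p : ℂ) ^ (e * m))⁻¹)).congr_fun fun j => ?_
    rw [detail_apply]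
    simp only [hI, zpow_add_one₀ hq]
    field_simp
  rw [h2, h3]
  field_simp

end Regularization

/-! ### The family of Riesz kernels -/

section Family

variable {p : ℕ} [Fact p.Prime] {n : ℕ} {c : Fin n → ℚ_[p]} {e m : ℕ}

theorem locallyIntegrable_log (hf : IsNormDiagonal c e m) :
    LocallyIntegrable fun x => Real.log ‖quadForm c x‖ := by
  intro x
  obtain ⟨k, hk⟩ := pow_unbounded_of_one_lt ‖quadForm c x‖ hf.one_lt_base
  refine ⟨lattice c e k, ?_, ?_⟩
  · filter_upwards [(continuous_quadForm c).norm.continuousAt.eventually_lt_const hk] with y hy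
    rw [mem_lattice, zpow_natCast]
    exact hy.le
  · set φ : (Fin n → ℚ_[p]) → ℂ := (lattice c e k).indicator 1 with hφ
    have hmem : φ ∈ schwartz p n := hf.mem_schwartz_iff.mpr ⟨k, k, fun y t ht => by
      have : y + t ∈ lattice c e k ↔ y ∈ lattice c e k := by
        rw [add_comm, hf.add_mem_lattice_iff ht]
      by_cases hy : y ∈ lattice c e k <;> simp [hφ, this, hy],
      fun y hy => Set.indicator_of_notMem hy _⟩
    have h1 := (integral_log_kernel hf).1 ⟨φ, hmem⟩
    -- at the origin the junk value `log 0 = 0` keeps the support in `{f ≠ 0}`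
    rw [integrableOn_iff_integrable_of_support_subset (by
      intro y hy h0
      apply hy
      simp [h0])] at h1
    have h2 := (h1.integrableOn (s := lattice c e k)).re
    refine IntegrableOn.congr_fun h2 (fun y hy => ?_) (measurableSet_lattice _)
    simp only [hφ, Set.indicator_of_mem hy, Pi.one_apply, mul_one]
    exact Complex.ofReal_re _

/-- The multiplier parameter `p ^ (e α)`. -/
def multiplier (p e : ℕ) (α : ℂ) : ℂ := (p : ℂ) ^ ((e : ℂ) * α)

theorem natCast_prime_ne_zero : (p : ℂ) ≠ 0 := by exact_mod_cast (Fact.out : p.Prime).ne_zero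

theorem multiplier_ne_zero (α : ℂ) : multiplier p e α ≠ 0 := by
  rw [multiplier, Complex.cpow_def_of_ne_zero natCast_prime_ne_zero]
  exact Complex.exp_ne_zero _

theorem multiplier_add (α β : ℂ) :
    multiplier p e (α + β) = multiplier p e α * multiplier p e β := by
  rw [multiplier, mul_add, Complex.cpow_add _ _ natCast_prime_ne_zero]
  rfl

theorem multiplier_zero (p e : ℕ) : multiplier p e 0 = 1 := by simp [multiplier]

theorem differentiable_multiplier : Differentiable ℂ (multiplier p e) := fun α => by
  unfold multiplier
  exact DifferentiableAt.const_cpow (by fun_prop) (Or.inl natCast_prime_ne_zero)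

theorem one_lt_norm_multiplier (hf : IsNormDiagonal c e m) {α : ℂ} (hα : 0 < α.re) :
    1 < ‖multiplier p e α‖ := by
  rw [multiplier, Complex.norm_natCast_cpow_of_pos (Fact.out : p.Prime).pos]
  refine Real.one_lt_rpow cast_prime_one_lt ?_
  have : (0 : ℝ) < e := by exact_mod_cast hf.exponent_pos
  rw [← Complex.ofReal_natCast, Complex.re_ofReal_mul]
  positivity

theorem cpow_mul_half_dim (hf : IsNormDiagonal c e m) :
    (p : ℂ) ^ ((e : ℂ) * ((n : ℂ) / 2)) = (p : ℂ) ^ (e * m) := by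
  rw [← Complex.cpow_natCast, hf.dim]
  congr 1
  push_cast
  ring

theorem cpow_mul_sub (hf : IsNormDiagonal c e m) (α : ℂ) :
    (p : ℂ) ^ ((e : ℂ) * (α - (n : ℂ) / 2)) = multiplier p e α / (p : ℂ) ^ (e * m) := by
  rw [mul_sub, Complex.cpow_sub _ _ natCast_prime_ne_zero, cpow_mul_half_dim hf]
  rfl

theorem gammaFactor_eq (hf : IsNormDiagonal c e m) (α : ℂ) :
    gammaFactor p n e α =
      (1 - (multiplier p e α)⁻¹) / (1 - multiplier p e α / (p : ℂ) ^ (e * m)) := by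
  rw [gammaFactor, cpow_mul_sub hf, Complex.cpow_neg]
  rfl

theorem mem_poles_iff (hf : IsNormDiagonal c e m) (α : ℂ) :
    α ∈ poles p n e ↔ multiplier p e α = (p : ℂ) ^ (e * m) := by
  have hlog : (Real.log p : ℂ) ≠ 0 := by
    exact_mod_cast (Real.log_pos (cast_prime_one_lt (p := p))).ne'
  have he : (e : ℂ) ≠ 0 := by exact_mod_cast hf.exponent_pos.ne'
  rw [← div_eq_one_iff_eq hf.index_ne_zero, ← cpow_mul_sub hf,
    Complex.cpow_def_of_ne_zero natCast_prime_ne_zero, Complex.exp_eq_one_iff,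
    ← Complex.natCast_log]
  refine exists_congr fun k => ?_
  constructor
  · rintro rfl
    field_simp
    ring
  · intro h
    have : α - (n : ℂ) / 2 = k * (2 * Real.pi * Complex.I) / (e * Real.log p) := by
      rw [eq_div_iff (mul_ne_zero he hlog), ← h]
      ring
    linear_combination this

theorem one_sub_ne_zero_of_notMem_poles (hf : IsNormDiagonal c e m) {α : ℂ}
    (hα : α ∉ poles p n e) : 1 - multiplier p e α / (p : ℂ) ^ (e * m) ≠ 0 := by
  rw [mem_poles_iff hf] at hα
  intro h
  exact hα ((div_eq_one_iff_eq hf.index_ne_zero).mp (sub_eq_zero.mp h).symm)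

theorem isOpen_compl_poles (hf : IsNormDiagonal c e m) : IsOpen (poles p n e)ᶜ := by
  have : poles p n e = {α | multiplier p e α = (p : ℂ) ^ (e * m)} :=
    Set.ext fun α => mem_poles_iff hf α
  rw [this]
  exact (isClosed_eq differentiable_multiplier.continuous continuous_const).isOpen_compl

theorem isPreconnected_compl_poles (p n e : ℕ) : IsPreconnected (poles p n e)ᶜ := by
  refine (Set.Countable.isConnected_compl_of_one_lt_rank ?_ ?_).isPreconnected
  · rw [Complex.rank_real_complex]; norm_num
  · refine (Set.countable_range fun k : ℤ =>
      (n : ℂ) / 2 + 2 * Real.pi * Complex.I * k / (e * Real.log p)).mono ?_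
    rintro α ⟨k, hk⟩
    exact ⟨k, hk.symm⟩

theorem ofReal_zpow_cpow (j : ℤ) (s : ℂ) :
    ((((p : ℝ) ^ e) ^ j : ℝ) : ℂ) ^ s = ((p : ℂ) ^ ((e : ℂ) * s)) ^ j := by
  have hp := cast_prime_pos (p := p)
  have h1 : ((((p : ℝ) ^ e) ^ j : ℝ) : ℂ) ≠ 0 := by
    exact_mod_cast (by positivity : ((p : ℝ) ^ e) ^ j ≠ 0)
  rw [Complex.cpow_def_of_ne_zero h1, Complex.cpow_def_of_ne_zero natCast_prime_ne_zero,
    ← Complex.exp_int_mul, ← Complex.ofReal_log (by positivity), Real.log_zpow, Real.log_pow,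
    ← Complex.natCast_log]
  congr 1
  push_cast
  ring

/-- The meromorphic continuation of the Riesz kernels; at the exceptional parameters its value is
the junk value `0`. -/
def continuation (hf : IsNormDiagonal c e m) (α : ℂ) : Distribution p n :=
  (1 - multiplier p e α / (p : ℂ) ^ (e * m))⁻¹ • regularized hf (multiplier p e α)

theorem differentiable_regularized (hf : IsNormDiagonal c e m) (φ : schwartz p n) :
    Differentiable ℂ fun α => regularized hf (multiplier p e α) φ := by
  obtain ⟨s, hs⟩ := exists_shellMean_sub_eq_zero hf φ
  have : (fun α => regularized hf (multiplier p e α) φ) = fun α => ∑ k ∈ s,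
      multiplier p e α ^ k * (shellMean c e m k φ.1 - shellMean c e m (k + 1) φ.1) := by
    funext α
    exact tsum_eq_sum fun k hk => by rw [hs k hk, mul_zero]
  rw [this]
  refine Differentiable.fun_sum fun k _ => Differentiable.mul_const (fun α => ?_) _
  exact (differentiable_multiplier α).zpow (Or.inl (multiplier_ne_zero α))

theorem isContinuation_continuation (hf : IsNormDiagonal c e m) :
    IsContinuation c e (continuation hf) := by
  have hG : ∀ α : ℂ, ∀ x (j : ℤ), ‖quadForm c x‖ = ((p : ℝ) ^ e) ^ j →
      (‖quadForm c x‖ : ℂ) ^ (α - (n : ℂ) / 2) = (multiplier p e α / (p : ℂ) ^ (e * m)) ^ j := by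
    intro α x j hx
    rw [hx, ofReal_zpow_cpow, cpow_mul_sub hf]
  have hD : Differentiable ℂ fun α => 1 - multiplier p e α / (p : ℂ) ^ (e * m) :=
    (differentiable_const _).sub (differentiable_multiplier.div_const _)
  refine ⟨fun α hα _ φ => ?_, fun α hα _ φ => ?_, fun φ α _ => ?_, fun φ α hα => ?_⟩
  · exact (integral_power_kernel hf (one_lt_norm_multiplier hf hα) (hG α) φ).1
  · change (1 - multiplier p e α / (p : ℂ) ^ (e * m))⁻¹ * regularized hf _ φ = _
    rw [(integral_power_kernel hf (one_lt_norm_multiplier hf hα) (hG α) φ).2, gammaFactor_eq hf]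
    ring
  · exact (hD.analyticAt α).meromorphicAt.inv.mul
      ((differentiable_regularized hf φ).analyticAt α).meromorphicAt
  · exact (((hD α).inv (one_sub_ne_zero_of_notMem_poles hf hα)).mul
      (differentiable_regularized hf φ α)).differentiableWithinAt

theorem IsContinuation.eq_of_notMem_poles (hf : IsNormDiagonal c e m) {Z Z' : ℂ → Distribution p n}
    (h : IsContinuation c e Z) (h' : IsContinuation c e Z') {α : ℂ} (hα : α ∉ poles p n e) :
    Z α = Z' α := by
  have hopen := isOpen_compl_poles hf
  ext φ
  -- a parameter in the right half-plane that is not exceptional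
  obtain ⟨z, hz, hz0⟩ : ∃ z ∉ poles p n e, 0 < z.re := by
    refine ⟨((n : ℝ) / 2 + 1 : ℝ), fun ⟨k, hk⟩ => ?_, ?_⟩
    · have := congrArg Complex.re hk
      rw [show ((n : ℂ) / 2 + 2 * Real.pi * Complex.I * k / (e * Real.log p)) =
        (((n : ℝ) / 2 : ℝ) : ℂ) + ((2 * Real.pi * k / (e * Real.log p) : ℝ) : ℂ) * Complex.I by
          push_cast; ring, Complex.add_re, Complex.ofReal_re, Complex.ofReal_re,
        Complex.re_ofReal_mul, Complex.I_re] at this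
      linarith
    · rw [Complex.ofReal_re]; positivity
  refine AnalyticOnNhd.eqOn_of_preconnected_of_eventuallyEq
    ((h.holomorphic φ).analyticOnNhd hopen) ((h'.holomorphic φ).analyticOnNhd hopen)
    (isPreconnected_compl_poles p n e) hz ?_ hα
  filter_upwards [hopen.mem_nhds hz,
    Complex.continuous_re.continuousAt.eventually_const_lt hz0] with β hβ hβ0
  rw [h.eq_integral β hβ0 hβ φ, h'.eq_integral β hβ0 hβ φ]

theorem isRieszFamily_kernel (hf : IsNormDiagonal c e m) :
    IsRieszFamily c e fun α => kernel hf (multiplier p e α) := by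
  refine ⟨⟨continuation hf, isContinuation_continuation hf, fun α hα => ?_⟩,
    locallyIntegrable_log hf, fun α hα φ => ?_⟩
  · change _ = (1 - multiplier p e α / (p : ℂ) ^ (e * m))⁻¹ • restrict (regularized hf _)
    rw [restrict_regularized hf (multiplier_ne_zero α),
      inv_smul_smul₀ (one_sub_ne_zero_of_notMem_poles hf hα)]
  · rw [(mem_poles_iff hf α).mp hα, (integral_log_kernel hf).2 φ, Complex.cpow_neg,
      cpow_mul_half_dim hf]

theorem IsRieszFamily.unique (hf : IsNormDiagonal c e m) {K K' : ℂ → LizorkinDistribution p n}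
    (h : IsRieszFamily c e K) (h' : IsRieszFamily c e K') : K = K' := by
  funext α
  by_cases hα : α ∈ poles p n e
  · ext φ
    rw [h.log_kernel α hα φ, h'.log_kernel α hα φ]
  · obtain ⟨Z, hZ, hK⟩ := h.continuation
    obtain ⟨Z', hZ', hK'⟩ := h'.continuation
    rw [hK α hα, hK' α hα, hZ.eq_of_notMem_poles hf hZ' hα]

end Family

end PadicRiesz

end

/-- For each of the forms in question there is exactly one family of Riesz kernels; it satisfies
`K_α ∗ K_β = K_{α+β}` in `Φ'`, and the kernels form an abelian group under convolution whose unit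
is the Dirac distribution. -/
theorem theorem3p1 (p : ℕ) [Fact p.Prime] (hp : p ≠ 2) (n : ℕ) (c : Fin n → ℚ_[p]) (e : ℕ)
    (hc : PadicRiesz.IsRieszForm p n c e) :
    ∃ K : ℂ → PadicRiesz.LizorkinDistribution p n,
      PadicRiesz.IsRieszFamily c e K ∧
      (∀ K' : ℂ → PadicRiesz.LizorkinDistribution p n, PadicRiesz.IsRieszFamily c e K' → K' = K) ∧
      (∀ α β : ℂ, PadicRiesz.IsConvolution (K α) (K β) (K (α + β))) ∧
      ∃ _ : CommGroup (Set.range K),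
        (∀ J L : Set.range K, PadicRiesz.IsConvolution J.1 L.1 (J * L).1) ∧
        (1 : Set.range K).1 = PadicRiesz.restrict (PadicRiesz.dirac p n) := by
  obtain ⟨m, hf⟩ := hc.isNormDiagonal hp
  have hfam := PadicRiesz.isRieszFamily_kernel hf
  have hconv : ∀ α β : ℂ, PadicRiesz.IsConvolution
      (PadicRiesz.kernel hf (PadicRiesz.multiplier p e α))
      (PadicRiesz.kernel hf (PadicRiesz.multiplier p e β))
      (PadicRiesz.kernel hf (PadicRiesz.multiplier p e (α + β))) := fun α β => by
    rw [PadicRiesz.multiplier_add]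
    exact PadicRiesz.isConvolution_kernel hf _ _
  obtain ⟨G, hG, hone⟩ := PadicRiesz.exists_commGroup_range hconv
  refine ⟨_, hfam, fun K' hK' => PadicRiesz.IsRieszFamily.unique hf hK' hfam, hconv, G, hG, ?_⟩
  rw [hone, PadicRiesz.multiplier_zero, PadicRiesz.kernel_one]
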